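/- Let $n,d,k\ge 1$ be integers and let $A$ be a real $n\times d$ matrix with rows $\vec\alpha_1,\dots,\vec\alpha_n$. Suppose that $A$ is badly approximable with approximation constant $C_A>0$, that is, $$\{A\mathbf h\}_\infty > \frac{C_A}{\|\mathbf h\|_\infty^{d/n}}\qquad\text{for all nonzero } \mathbf h\in\mathbb Z^d,$$ where $\|\cdot\|_\infty$ is the supremum norm and $\{x\}_\infty$ is the supremum-norm distance from $x\in\mathbb R^n$ to the nearest point of $\mathbb Z^n$. Consider the random walk on the torus $\mathbb T^d=\mathbb R^d/\mathbb Z^d$ that starts at $0$ and at each step chooses one of the $\vec\alpha_i$ with probability $1/n$ and adds or subtracts it (modulo $1$) with probability $1/2$ each; thus its generating measure is $Q=\frac1{2n}\sum_{i=1}^n(\delta_{\vec\alpha_i}+\delta_{-\vec\alpha_i})$, and its distribution after $k$ steps is the $k$-th convolution power $Q^{*k}$. Let $U$ be the Haar probability measure on $\mathbb T^d$ and let $$D(Q^{*k})=\sup_B|Q^{*k}(B)-U(B)|$$ be the discrepancy, where $B$ ranges over all boxes in $\mathbb T^d$, i.e. the images of $[a_1,b_1)\times\cdots\times[a_d,b_d)$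 with $a_i\le b_i\le a_i+1$. Then $$D(Q^{*k})\le\left(\frac32\right)^d 20\left(\frac{n}{C_A\sqrt2}\right)^{n/d}k^{-n/(2d)}.$$ -/

import Mathlib

open MeasureTheory

namespace TorusWalk

noncomputable section

/-- The torus `ℝ^d / ℤ^d`. Its `volume` is the Haar probability measure. -/
abbrev Torus (d : ℕ) : Type := Fin d → UnitAddCircle

/-- The class mod `ℤ^d` of a point of `ℝ^d`. -/
def toTorus {d : ℕ} (x : Fin d → ℝ) : Torus d := fun i => (x i : UnitAddCircle)

/-- The generating measure of the random walk whose generators are the rows of `A` mod 1: choose a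
row uniformly among the `n` rows, then add or subtract it with probability `1/2` each. -/
def generatingMeasure {n d : ℕ} (A : Matrix (Fin n) (Fin d) ℝ) : Measure (Torus d) :=
  (2 * (n : ENNReal))⁻¹ •
    ∑ i : Fin n, (Measure.dirac (toTorus (A i)) + Measure.dirac (-toTorus (A i)))

/-- The `k`-th convolution power of a measure on the torus. -/
def convPower {d : ℕ} (Q : Measure (Torus d)) : ℕ → Measure (Torus d)
  | 0 => Measure.dirac 0
  | k + 1 => Measure.conv (convPower Q k) Q

/-- The box `[a₁, b₁) × ⋯ × [a_d, b_d)` of `ℝ^d`, projected to the torus. -/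
def box {d : ℕ} (a b : Fin d → ℝ) : Set (Torus d) :=
  toTorus '' Set.univ.pi fun i => Set.Ico (a i) (b i)

/-- The values `|P(B) - U(B)|` for all boxes `B` in the torus with side lengths at most `1`;
boxes may wrap around. -/
def boxDeviations {d : ℕ} (P : Measure (Torus d)) : Set ℝ :=
  {r | ∃ a b : Fin d → ℝ, (∀ i, a i ≤ b i ∧ b i ≤ a i + 1) ∧
    r = |P.real (box a b) - (volume : Measure (Torus d)).real (box a b)|}

/-- The discrepancy of `P` from Haar measure. -/
def discrepancy {d : ℕ} (P : Measure (Torus d)) : ℝ := sSup (boxDeviations P)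

/-- For a finite measure the supremum in `discrepancy` is a genuine one. -/
theorem bddAbove_boxDeviations {d : ℕ} (P : Measure (Torus d)) [IsFiniteMeasure P] :
    BddAbove (boxDeviations P) := by
  refine ⟨P.real Set.univ + (volume : Measure (Torus d)).real Set.univ, ?_⟩
  rintro r ⟨a, b, -, rfl⟩
  have h1 : P.real (box a b) ≤ P.real Set.univ := measureReal_mono (Set.subset_univ _)
  have h2 : (volume : Measure (Torus d)).real (box a b) ≤
    (volume : Measure (Torus d)).real Set.univ := measureReal_mono (Set.subset_univ _)
  have h3 : 0 ≤ P.real (box a b) := measureReal_nonneg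
  have h4 : 0 ≤ (volume : Measure (Torus d)).real (box a b) := measureReal_nonneg
  rw [abs_le]
  constructor <;> linarith

/-- The supremum distance from `x` to the nearest integral point. -/
def distInt {n : ℕ} (x : Fin n → ℝ) : ℝ :=
  Metric.infDist x (Set.range fun (z : Fin n → ℤ) (i : Fin n) => (z i : ℝ))

/-- `C > 0` is an approximation constant of the `n × d` matrix `A`: for all nonzero integral `h`,
`{A h}_∞ > C / ‖h‖_∞ ^ (d / n)`. The norm on `Fin d → ℤ` is the supremum norm. -/
def IsApproximationConstant {n d : ℕ} (A : Matrix (Fin n) (Fin d) ℝ) (C : ℝ) : Prop :=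
  0 < C ∧ ∀ h : Fin d → ℤ, h ≠ 0 →
    distInt (A.mulVec fun j => (h j : ℝ)) > C / ‖h‖ ^ ((d : ℝ) / (n : ℝ))

end

end TorusWalk

namespace TorusWalk

/-! Discrepancy is controlled by Fourier coefficients through an Erdős–Turán–Koksma inequality with
explicit constants, and the coefficients of the walk are small because `A` is badly approximable.

For the inequality, the indicator of an arc is majorized by Selberg's trigonometric polynomial of
degree below `N`, assembled from two copies of Vaaler's majorant of the sawtooth; the majorant
property rests on the concavity of `t cot t` (`mul_cot_sub_le`). The product of these majorants over
the coordinates bounds the measure of a box from above (`measureReal_pi_le`). Since the complement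
of an arc is an arc, upper bounds for all boxes imply lower bounds, at the price of a factor `d`
(`volume_pi_sub_le`).

The coefficient of the walk at `h` is `((1/n) ∑ cos (2π (A h)_i)) ^ k`, of modulus at most `exp
(-(4k/n) ∑ r_i²)`, where `r_i` is the signed distance from `2 (A h)_i` to the nearest integer. Bad
approximability keeps the vectors `r` for `‖h‖ ≤ R` away from the origin and from each other, so
they fall into distinct cells of a cubic grid and their Gaussian sum is dominated by a product of
geometric series (`sum_exp_neg_le`). Half of the exponent pays for this count and the other half
more than compensates the weight `1/‖h‖` (`fourierError_walk_le`). The cutoff `R`, of order `k ^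
(n/(2d))`, balances the two error terms; for small `R` the claimed bound is at least `1` and hence
trivial. -/

/-! ### Concavity of `t cot t` -/

theorem mul_cos_le_sin {u : ℝ} (h0 : 0 ≤ u) (hpi : u ≤ Real.pi) : u * Real.cos u ≤ Real.sin u := by
  rcases h0.eq_or_lt with rfl | h0
  · simp
  rcases lt_or_ge u (Real.pi / 2) with h | h
  · have hc : 0 < Real.cos u := Real.cos_pos_of_mem_Ioo ⟨by linarith, h⟩
    have := (Real.lt_tan h0 h).le
    rwa [Real.tan_eq_sin_div_cos, le_div_iff₀ hc] at this
  · have hc : Real.cos u ≤ 0 := Real.cos_nonpos_of_pi_div_two_le_of_le h (by linarith)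
    have hs : 0 ≤ Real.sin u := Real.sin_nonneg_of_nonneg_of_le_pi h0.le hpi
    nlinarith

/-- The tangent-line inequality for the concave function `t ↦ t cot t` on `(-π, π)`. -/
theorem mul_cot_sub_le {A B : ℝ} (hA : -Real.pi < A) (hB : B < Real.pi) (hAB : A < B)
    (hA0 : A ≠ 0) (hB0 : B ≠ 0) :
    B * Real.cot B - A * Real.cot A ≤ (B - A) * (Real.cot A - A / Real.sin A ^ 2) := by
  simp only [Real.cot_eq_cos_div_sin]
  have key (hsA : Real.sin A ≠ 0) (hsB : Real.sin B ≠ 0) :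
      B * (Real.cos B / Real.sin B) - A * (Real.cos A / Real.sin A) -
        (B - A) * (Real.cos A / Real.sin A - A / Real.sin A ^ 2) =
      (-(B * Real.sin A * Real.sin (B - A)) + A * (B - A) * Real.sin B) /
        (Real.sin A ^ 2 * Real.sin B) := by
    rw [Real.sin_sub]
    field_simp
    ring
  rw [← sub_nonpos]
  rcases lt_or_gt_of_ne hA0 with hA1 | hA1
  · have hsA : Real.sin A < 0 := Real.sin_neg_of_neg_of_neg_pi_lt hA1 hA
    rcases lt_or_gt_of_ne hB0 with hB1 | hB1
    · have hsB : Real.sin B < 0 := Real.sin_neg_of_neg_of_neg_pi_lt hB1 (by linarith)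
      rw [key hsA.ne hsB.ne]
      refine div_nonpos_of_nonneg_of_nonpos ?_
        (mul_nonpos_of_nonneg_of_nonpos (sq_nonneg _) hsB.le)
      obtain ⟨b, rfl⟩ : ∃ b, B = -b := ⟨-B, by ring⟩
      obtain ⟨D, rfl⟩ : ∃ D, A = -b - D := ⟨-b - A, by ring⟩
      have hb : 0 < b := by linarith
      have hD : 0 < D := by linarith
      have hs : 0 < Real.sin b := Real.sin_pos_of_pos_of_lt_pi hb (by linarith)
      have hsD : 0 < Real.sin D := Real.sin_pos_of_pos_of_lt_pi hD (by linarith)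
      have h1 := mul_cos_le_sin hb.le (by linarith)
      have h2 := Real.sin_le hD.le
      have h3 : Real.sin D * Real.cos D ≤ D :=
        (mul_le_of_le_one_right hsD.le (Real.cos_le_one D)).trans h2
      have h4 : Real.sin D ^ 2 ≤ D ^ 2 := pow_le_pow_left₀ hsD.le h2 2
      have e1 : -b - D = -(b + D) := by ring
      have e2 : -b - -(b + D) = D := by ring
      rw [e1, e2, Real.sin_neg, Real.sin_neg, Real.sin_add]
      have h5 := mul_le_mul_of_nonneg_left h3 (mul_pos hb hs).le
      have h6 := mul_le_mul_of_nonneg_right h1 (sq_nonneg (Real.sin D))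
      have h7 := mul_le_mul_of_nonneg_left h4 hs.le
      linarith
    -- Across the removable singularity: `B cot B ≤ 1`, while the tangent at `A` takes the value `A²
    -- / sin² A ≥ 1` at `0` and has nonnegative slope.
    · have hsB : 0 < Real.sin B := Real.sin_pos_of_pos_of_lt_pi hB1 hB
      have h1 := mul_cos_le_sin hB1.le hB.le
      have h2 : B * (Real.cos B / Real.sin B) ≤ 1 := by
        rw [← mul_div_assoc, div_le_one hsB]; exact h1
      have h3 : Real.sin A ^ 2 ≤ A ^ 2 := by
        rw [sq_le_sq]; exact Real.abs_sin_le_abs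
      have h4 : 1 ≤ A ^ 2 / Real.sin A ^ 2 := by
        rw [one_le_div (sq_pos_of_neg hsA)]; exact h3
      have h5 : 0 ≤ Real.cos A / Real.sin A - A / Real.sin A ^ 2 := by
        have h := mul_cos_le_sin (u := -A) (by linarith) (by linarith)
        rw [Real.cos_neg, Real.sin_neg] at h
        have : Real.cos A / Real.sin A - A / Real.sin A ^ 2
          = (Real.cos A * Real.sin A - A) / Real.sin A ^ 2 := by field_simp
        rw [this]
        refine div_nonneg ?_ (sq_nonneg _)
        rcases le_or_gt 0 (Real.cos A) with hc | hc
        · have := Real.sin_le (x := -A) (by linarith)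
          rw [Real.sin_neg] at this
          nlinarith [Real.cos_le_one A]
        · nlinarith
      have h6 := mul_nonneg hB1.le h5
      have h7 : A * (A / Real.sin A ^ 2) = A ^ 2 / Real.sin A ^ 2 := by ring
      linarith
  · have hsA : 0 < Real.sin A := Real.sin_pos_of_pos_of_lt_pi hA1 (by linarith)
    have hB1 : 0 < B := hA1.trans hAB
    have hsB : 0 < Real.sin B := Real.sin_pos_of_pos_of_lt_pi hB1 hB
    rw [key hsA.ne' hsB.ne']
    refine div_nonpos_of_nonpos_of_nonneg ?_ (by positivity)
    obtain ⟨D, rfl⟩ : ∃ D, B = A + D := ⟨B - A, by ring⟩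
    have hD : 0 < D := by linarith
    have hsD : 0 < Real.sin D := Real.sin_pos_of_pos_of_lt_pi hD (by linarith)
    have h1 := mul_cos_le_sin hA1.le (by linarith)
    have h2 := mul_cos_le_sin hD.le (by linarith)
    -- The numerator becomes `A sin A (D cos D - sin D) + D sin D (A cos A - sin A)`, and both
    -- brackets are nonpositive.
    rw [add_sub_cancel_left, Real.sin_add]
    have h3 := mul_le_mul_of_nonneg_left h1 (mul_pos hD hsD).le
    have h4 := mul_le_mul_of_nonneg_left h2 (mul_pos hA1 hsA).le
    linarith

/-! ### Exponentials, the Fejér kernel and the conjugate Dirichlet kernel -/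

/-- The monomial `x ↦ exp(2πihx)`. -/
noncomputable def expChar (h : ℤ) (x : ℝ) : ℂ := Complex.exp (2 * Real.pi * Complex.I * h * x)

/-- The Fejér kernel with `N` terms, normalized to have value `1` at `0`. -/
noncomputable def fejer (N : ℕ) (x : ℝ) : ℝ :=
  ((∑ j ∈ Finset.range N, Real.cos (2 * Real.pi * j * x)) ^ 2 +
    (∑ j ∈ Finset.range N, Real.sin (2 * Real.pi * j * x)) ^ 2) / (N : ℝ) ^ 2

/-- The conjugate Dirichlet kernel. -/
noncomputable def sineSum (N : ℕ) (x : ℝ) : ℝ := ∑ j ∈ Finset.range N, Real.sin (2 * Real.pi * j * x)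

theorem sin_mul_cosSum (N : ℕ) (x : ℝ) :
    2 * Real.sin (Real.pi * x) * ∑ j ∈ Finset.range N, Real.cos (2 * Real.pi * j * x) =
      Real.sin (2 * Real.pi * N * x - Real.pi * x) + Real.sin (Real.pi * x) := by
  induction N with
  | zero => simp
  | succ N ih =>
    rw [Finset.sum_range_succ, mul_add, ih]
    have e1 : 2 * Real.pi * ((N + 1 : ℕ) : ℝ) * x - Real.pi * x
      = 2 * Real.pi * N * x + Real.pi * x := by push_cast; ring
    rw [e1, Real.sin_sub, Real.sin_add]
    ring

theorem sin_mul_sineSum (N : ℕ) (x : ℝ) :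
    2 * Real.sin (Real.pi * x) * sineSum N x =
      Real.cos (Real.pi * x) - Real.cos (2 * Real.pi * N * x - Real.pi * x) := by
  unfold sineSum
  induction N with
  | zero => simp
  | succ N ih =>
    rw [Finset.sum_range_succ, mul_add, ih]
    have e1 : 2 * Real.pi * ((N + 1 : ℕ) : ℝ) * x - Real.pi * x
      = 2 * Real.pi * N * x + Real.pi * x := by push_cast; ring
    rw [e1, Real.cos_sub, Real.cos_add]
    ring

theorem fejer_eq {N : ℕ} {x : ℝ} (hx : Real.sin (Real.pi * x) ≠ 0) :
    fejer N x = Real.sin (Real.pi * N * x) ^ 2 / ((N : ℝ) ^ 2 * Real.sin (Real.pi * x) ^ 2) := by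
  have h1 := sin_mul_cosSum N x
  have h2 := sin_mul_sineSum N x
  unfold sineSum at h2
  have h3 : (2 * Real.sin (Real.pi * x)) ^ 2 *
      ((∑ j ∈ Finset.range N, Real.cos (2 * Real.pi * j * x)) ^ 2 +
        (∑ j ∈ Finset.range N, Real.sin (2 * Real.pi * j * x)) ^ 2) =
      4 * Real.sin (Real.pi * N * x) ^ 2 := by
    rw [mul_add, ← mul_pow, ← mul_pow, h1, h2]
    have e : 2 * Real.pi * N * x = 2 * (Real.pi * N * x) := by ring
    rw [e, Real.sin_sub, Real.cos_sub, Real.sin_two_mul, Real.cos_two_mul]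
    have a1 := Real.sin_sq_add_cos_sq (Real.pi * x)
    have a2 := Real.sin_sq_add_cos_sq (Real.pi * N * x)
    have a3 : Real.cos (Real.pi * x) ^ 2 = 1 - Real.sin (Real.pi * x) ^ 2 := by linarith
    have a4 : Real.cos (Real.pi * N * x) ^ 2 = 1 - Real.sin (Real.pi * N * x) ^ 2 := by linarith
    generalize Real.sin (Real.pi * x) = s at *
    generalize Real.cos (Real.pi * x) = c at *
    generalize Real.sin (Real.pi * N * x) = S at *
    generalize Real.cos (Real.pi * N * x) = K at *
    ring_nf
    have a5 : K ^ 4 = (1 - S ^ 2) ^ 2 := by rw [← a4]; ring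
    rw [a5, a3, a4]
    ring
  unfold fejer
  rw [show (∑ j ∈ Finset.range N, Real.cos (2 * Real.pi * j * x)) ^ 2 +
        (∑ j ∈ Finset.range N, Real.sin (2 * Real.pi * j * x)) ^ 2 =
        Real.sin (Real.pi * N * x) ^ 2 / Real.sin (Real.pi * x) ^ 2 by
    rw [eq_div_iff (pow_ne_zero _ hx)]; linarith]
  rw [div_div, mul_comm ((N : ℝ) ^ 2)]

theorem sineSum_eq {N : ℕ} {x : ℝ} (hx : Real.sin (Real.pi * x) ≠ 0) :
    sineSum N x = Real.sin (Real.pi * N * x) ^ 2 * Real.cot (Real.pi * x) -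
      Real.sin (Real.pi * N * x) * Real.cos (Real.pi * N * x) := by
  have h2 := sin_mul_sineSum N x
  have e : 2 * Real.pi * N * x = 2 * (Real.pi * N * x) := by ring
  rw [e, Real.cos_sub, Real.sin_two_mul, Real.cos_two_mul] at h2
  rw [Real.cot_eq_cos_div_sin]
  field_simp
  have a2 := Real.sin_sq_add_cos_sq (Real.pi * N * x)
  have a4 : Real.cos (Real.pi * N * x) ^ 2 = 1 - Real.sin (Real.pi * N * x) ^ 2 := by linarith
  rw [a4] at h2
  linear_combination h2 / 2

theorem expChar_add (h : ℤ) (x y : ℝ) : expChar h (x + y) = expChar h x * expChar h y := by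
  unfold expChar
  rw [← Complex.exp_add]
  push_cast
  ring_nf

theorem expChar_zero_left (x : ℝ) : expChar 0 x = 1 := by simp [expChar]

theorem expChar_zero_right (h : ℤ) : expChar h 0 = 1 := by simp [expChar]

theorem expChar_add_left (h l : ℤ) (x : ℝ) : expChar (h + l) x = expChar h x * expChar l x := by
  unfold expChar
  rw [← Complex.exp_add]
  push_cast
  ring_nf

theorem expChar_neg_right (h : ℤ) (x : ℝ) : expChar h (-x) = expChar (-h) x := by
  unfold expChar
  push_cast
  ring_nf

theorem expChar_eq (h : ℤ) (x : ℝ) :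
    expChar h x = Real.cos (2 * Real.pi * h * x) + Real.sin (2 * Real.pi * h * x) * Complex.I := by
  rw [Complex.ofReal_cos, Complex.ofReal_sin, ← Complex.exp_mul_I]
  unfold expChar
  push_cast
  ring_nf

theorem expChar_mul_intCast (h l : ℤ) : expChar h l = 1 := by
  unfold expChar
  rw [Complex.exp_eq_one_iff]
  exact ⟨h * l, by push_cast; ring⟩

theorem expChar_natCast_mul (h : ℤ) (j : ℕ) (x : ℝ) : expChar h (j * x) = expChar h x ^ j := by
  unfold expChar
  rw [← Complex.exp_nat_mul]
  push_cast
  ring_nf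

theorem norm_expChar (h : ℤ) (x : ℝ) : ‖expChar h x‖ = 1 := by
  have : expChar h x = Complex.exp ((2 * Real.pi * h * x : ℝ) * Complex.I) := by
    unfold expChar; push_cast; ring_nf
  rw [this, Complex.norm_exp_ofReal_mul_I]

theorem continuous_expChar (h : ℤ) : Continuous (expChar h) := by
  unfold expChar; fun_prop

theorem sum_expChar_div {N : ℕ} {h : ℤ} (h0 : h ≠ 0) (hN : |h| < N) :
    ∑ j ∈ Finset.range N, expChar h (j / N) = 0 := by
  have hN0 : (N : ℝ) ≠ 0 := by
    have : (0 : ℤ) < N := (abs_nonneg h).trans_lt hN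
    exact_mod_cast this.ne'
  have h1 : ∀ j ∈ Finset.range N, expChar h (j / N) = expChar h (1 / N) ^ j := fun j _ => by
    rw [← expChar_natCast_mul]; ring_nf
  rw [Finset.sum_congr rfl h1]
  have h2 := geom_sum_mul (expChar h (1 / N)) N
  rw [← expChar_natCast_mul, mul_one_div_cancel hN0] at h2
  have h3 : expChar h 1 = 1 := by simpa using expChar_mul_intCast h 1
  rw [h3, sub_self, mul_eq_zero, sub_eq_zero] at h2
  refine h2.resolve_right fun h4 => ?_
  unfold expChar at h4
  rw [Complex.exp_eq_one_iff] at h4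
  obtain ⟨n, hn⟩ := h4
  have hN1 : (N : ℂ) ≠ 0 := by exact_mod_cast hN0
  have h5 : (h : ℂ) = n * N := by
    have h6 := Complex.two_pi_I_ne_zero
    push_cast at hn
    field_simp at hn
    rw [hn]; ring
  have h7 : h = n * N := by exact_mod_cast h5
  have hn0 : n ≠ 0 := by rintro rfl; simp at h7; exact h0 h7
  rw [h7, abs_mul, Nat.abs_cast] at hN
  have : 1 ≤ |n| := Int.one_le_abs hn0
  nlinarith [abs_nonneg n]

theorem fejer_eq_sum (N : ℕ) (x : ℝ) :
    (fejer N x : ℂ) = (∑ i ∈ Finset.range N, ∑ l ∈ Finset.range N, expChar ((i : ℤ) - l) x) / N ^ 2 := by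
  have hc : ∀ i l : ℕ, expChar ((i : ℤ) - l) x = expChar i x * expChar (-l) x := fun i l => by
    rw [sub_eq_add_neg, expChar_add_left]
  simp_rw [hc, ← Finset.mul_sum, ← Finset.sum_mul]
  simp_rw [expChar_eq, Finset.sum_add_distrib, ← Finset.sum_mul]
  unfold fejer
  push_cast
  simp only [neg_mul, mul_neg, Complex.cos_neg, Complex.sin_neg, Finset.sum_neg_distrib]
  congr 1
  ring_nf
  rw [Complex.I_sq]
  ring_nf

/-- All frequencies `i - l` of the kernel are below `N` in absolute value, so summing over the nodes
`j / N` leaves only the diagonal. This partition of unity lets `x - 1/2` be compared with the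
majorant node by node. -/
theorem sum_fejer {N : ℕ} (hN : 0 < N) (x : ℝ) :
    ∑ j ∈ Finset.range N, fejer N (x - j / N) = 1 := by
  have hN0 : (N : ℂ) ≠ 0 := by exact_mod_cast hN.ne'
  have h : ((∑ j ∈ Finset.range N, fejer N (x - j / N) : ℝ) : ℂ) = 1 := by
    push_cast
    simp_rw [fejer_eq_sum, ← Finset.sum_div]
    rw [Finset.sum_comm]
    have h1 : ∀ i ∈ Finset.range N, ∑ j ∈ Finset.range N, ∑ l ∈ Finset.range N,
        expChar ((i : ℤ) - l) (x - j / N) = N := fun i hi => by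
      rw [Finset.sum_comm]
      rw [Finset.sum_eq_single_of_mem i hi]
      · simp [expChar_zero_left]
      · intro l hl hli
        simp_rw [sub_eq_add_neg x, expChar_add, ← Finset.mul_sum, expChar_neg_right]
        rw [Finset.mem_range] at hi hl
        rw [sum_expChar_div (by omega), mul_zero]
        rw [abs_lt]; omega
    rw [Finset.sum_congr rfl h1]
    simp
    field_simp
  exact_mod_cast h

/-! ### Vaaler's majorant of the sawtooth -/

/-- The value at `j / N` of the Vaaler majorant of the sawtooth function. -/
noncomputable def vaalerNode (N j : ℕ) : ℝ := if j = 0 then 1 / 2 else j / N - 1 / 2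

/-- Vaaler's trigonometric polynomial of degree less than `N` which majorizes the sawtooth function. -/
noncomputable def vaaler (N : ℕ) (x : ℝ) : ℝ :=
  ∑ j ∈ Finset.range N, (vaalerNode N j * fejer N (x - j / N) +
    sineSum N (x - j / N) / (Real.pi * N ^ 2)) - sineSum N x / (Real.pi * N)

theorem continuous_sineSum (N : ℕ) : Continuous (sineSum N) := by unfold sineSum; fun_prop

theorem continuous_fejer (N : ℕ) : Continuous (fejer N) := by unfold fejer; fun_prop

theorem continuous_vaaler (N : ℕ) : Continuous (vaaler N) := by
  have h1 := continuous_sineSum N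
  have h2 := continuous_fejer N
  unfold vaaler
  fun_prop

theorem sin_pi_mul_ne_zero {N : ℕ} (hN : 0 < N) {x : ℝ} (hx : Real.sin (Real.pi * N * x) ≠ 0) (j : ℕ) :
    Real.sin (Real.pi * (x - j / N)) ≠ 0 := by
  have hN0 : (N : ℝ) ≠ 0 := by exact_mod_cast hN.ne'
  intro h
  rw [Real.sin_eq_zero_iff] at h
  obtain ⟨m, hm⟩ := h
  apply hx
  rw [Real.sin_eq_zero_iff]
  refine ⟨m * N + j, ?_⟩
  have : x = m + j / N := by
    have : Real.pi * m = Real.pi * (x - j / N) := by rw [← hm]; ring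
    have := mul_left_cancel₀ Real.pi_ne_zero this
    linarith
  rw [this]
  push_cast
  field_simp

theorem sin_pi_mul_shift {N : ℕ} (hN : 0 < N) (x : ℝ) (j : ℕ) :
    Real.sin (Real.pi * N * (x - j / N)) ^ 2 = Real.sin (Real.pi * N * x) ^ 2 ∧
    Real.sin (Real.pi * N * (x - j / N)) * Real.cos (Real.pi * N * (x - j / N)) =
      Real.sin (Real.pi * N * x) * Real.cos (Real.pi * N * x) := by
  have hN0 : (N : ℝ) ≠ 0 := by exact_mod_cast hN.ne'
  have e : Real.pi * N * (x - j / N) = Real.pi * N * x - j * Real.pi := by field_simp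
  have hs : Real.sin (j * Real.pi) = 0 := Real.sin_nat_mul_pi j
  have hc : Real.cos (j * Real.pi) ^ 2 = 1 := by
    have := Real.sin_sq_add_cos_sq (j * Real.pi)
    rw [hs] at this; linarith
  rw [e, Real.sin_sub, Real.cos_sub, hs]
  constructor
  · linear_combination Real.sin (Real.pi * N * x) ^ 2 * hc
  · linear_combination Real.sin (Real.pi * N * x) * Real.cos (Real.pi * N * x) * hc

/-- Antiderivative of `cot (π t) / π - t / sin² (π t)`: step inequality. -/
theorem mul_cot_step {N : ℕ} (hN : 0 < N) {s : ℝ} (hs : -1 < s) (ht : s + 1 / N < 1)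
    (hs0 : s ≠ 0) (ht0 : s + 1 / N ≠ 0) :
    N * ((s + 1 / N) * Real.cot (Real.pi * (s + 1 / N)) - s * Real.cot (Real.pi * s)) / Real.pi ≤
      Real.cot (Real.pi * s) / Real.pi - s / Real.sin (Real.pi * s) ^ 2 := by
  have hN0 : (0 : ℝ) < N := by exact_mod_cast hN
  have hpi := Real.pi_pos
  have h := mul_cot_sub_le (A := Real.pi * s) (B := Real.pi * (s + 1 / N)) (by nlinarith)
    (by nlinarith) (by have : 0 < 1 / (N : ℝ) := by positivity
                       nlinarith) (by positivity) (by positivity)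
  have e1 : Real.pi * (s + 1 / N) - Real.pi * s = Real.pi / N := by ring
  rw [e1] at h
  generalize Real.cot (Real.pi * (s + 1 / N)) = c1 at *
  generalize Real.cot (Real.pi * s) = c2 at *
  generalize Real.sin (Real.pi * s) ^ 2 = S at *
  have h2 := mul_le_mul_of_nonneg_left h (show 0 ≤ N / Real.pi ^ 2 by positivity)
  have e3 : N / Real.pi ^ 2 * (Real.pi * (s + 1 / N) * c1 - Real.pi * s * c2)
     = N * ((s + 1 / N) * c1 - s * c2) / Real.pi := by field_simp
  have e4 : N / Real.pi ^ 2 * (Real.pi / N * (c2 - Real.pi * s / S)) = c2 / Real.pi - s / S := by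
    field_simp
  rwa [e3, e4] at h2

/-- `vaaler N` is a Hermite interpolant: it matches the value and the slope `1` of the sawtooth at
the nodes `j / N` with `0 < j < N`, and takes the upper value `1/2` of the jump at `0`. Away from
the nodes its excess over `x - 1/2` is `sin² (πNx) / N²` times the gap between a sum of tangent
slopes and the telescoped increments of a concave function. -/
theorem vaaler_ge_of_sin_ne_zero {N : ℕ} (hN : 0 < N) {x : ℝ} (hx0 : 0 < x) (hx1 : x < 1)
    (hx : Real.sin (Real.pi * N * x) ≠ 0) : x - 1 / 2 ≤ vaaler N x := by
  have hN0 : (0 : ℝ) < N := by exact_mod_cast hN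
  have hpi := Real.pi_pos
  have hne := sin_pi_mul_ne_zero hN hx
  set S := Real.sin (Real.pi * N * x) with hS
  set K := Real.cos (Real.pi * N * x) with hK
  -- `φ` is the derivative of `s cot (πs) / π`, and `Φ` is `N` times that antiderivative.
  let φ : ℝ → ℝ := fun s => Real.cot (Real.pi * s) / Real.pi - s / Real.sin (Real.pi * s) ^ 2
  let Φ : ℝ → ℝ := fun s => N * (s * Real.cot (Real.pi * s)) / Real.pi
  have hx00 : Real.sin (Real.pi * x) ≠ 0 := by simpa using hne 0
  have hcot1 : Real.cot (Real.pi * (x - 1)) = Real.cot (Real.pi * x) := by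
    rw [mul_sub, mul_one, Real.cot_eq_cos_div_sin, Real.cos_sub_pi, Real.sin_sub_pi, neg_div_neg_eq,
      Real.cot_eq_cos_div_sin]
  have hsum : ∑ j ∈ Finset.range N, φ (x - (j + 1 : ℕ) / N) ≥ N * Real.cot (Real.pi * x) / Real.pi := by
    have h1 : ∀ j ∈ Finset.range N, Φ (x - (j : ℕ) / N) - Φ (x - (j + 1 : ℕ) / N) ≤
        φ (x - (j + 1 : ℕ) / N) := by
      intro j hj
      rw [Finset.mem_range] at hj
      have hj1 : ((j + 1 : ℕ) : ℝ) / N ≤ 1 := by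
        rw [div_le_one hN0]; exact_mod_cast hj
      have hj0 : (0 : ℝ) ≤ (j : ℝ) / N := by positivity
      have e : x - (j : ℝ) / N = x - ((j + 1 : ℕ) : ℝ) / N + 1 / N := by push_cast; ring
      have := mul_cot_step hN (s := x - ((j + 1 : ℕ) : ℝ) / N) (by linarith) (by linarith)
        (fun h => hne (j + 1) (by rw [h]; simp))
        (fun h => hne j (by rw [e, h]; simp))
      rw [← e] at this
      refine le_trans (le_of_eq ?_) this
      simp only [Φ]
      ring
    have h2 := Finset.sum_le_sum h1
    -- The telescoped sum is `Φ x - Φ (x - 1)`, which equals `N cot (πx) / π` because the cotangent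
    -- has the same value at both ends.
    rw [Finset.sum_range_sub' (fun j : ℕ => Φ (x - (j : ℕ) / N))] at h2
    refine le_trans (le_of_eq ?_) h2
    simp only [Φ]
    rw [div_self hN0.ne', hcot1]
    simp
    ring
  -- Trading the node `0` for the node `1` costs exactly `1 / sin² (πx)`. The same term comes from
  -- using `1/2` instead of `-1/2` as the node value at `0`.
  have hshift : ∑ j ∈ Finset.range N, φ (x - (j + 1 : ℕ) / N) =
      ∑ j ∈ Finset.range N, φ (x - (j : ℕ) / N) + 1 / Real.sin (Real.pi * x) ^ 2 := by
    have h1 := Finset.sum_range_succ (fun j : ℕ => φ (x - (j : ℕ) / N)) N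
    rw [Finset.sum_range_succ'] at h1
    have h2 : φ (x - (N : ℕ) / N) = φ (x - (0 : ℕ) / N) + 1 / Real.sin (Real.pi * x) ^ 2 := by
      simp only [φ]
      rw [div_self hN0.ne', hcot1]
      have : Real.sin (Real.pi * (x - 1)) ^ 2 = Real.sin (Real.pi * x) ^ 2 := by
        rw [mul_sub, mul_one, Real.sin_sub_pi, neg_sq]
      rw [this]
      simp
      ring
    rw [h2] at h1
    linarith
  have hid : vaaler N x - (x - 1 / 2) = S ^ 2 / N ^ 2 *
      (∑ j ∈ Finset.range N, φ (x - (j : ℕ) / N) + 1 / Real.sin (Real.pi * x) ^ 2 -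
        N * Real.cot (Real.pi * x) / Real.pi) := by
    have h1 : x - 1 / 2 = ∑ j ∈ Finset.range N, (x - 1 / 2) * fejer N (x - j / N) := by
      rw [← Finset.mul_sum, sum_fejer hN, mul_one]
    have h2 : ∀ j ∈ Finset.range N, vaalerNode N j * fejer N (x - j / N) +
        sineSum N (x - j / N) / (Real.pi * N ^ 2) - (x - 1 / 2) * fejer N (x - j / N) =
        S ^ 2 / N ^ 2 * φ (x - (j : ℕ) / N) + (if j = 0 then fejer N x else 0) -
          S * K / (Real.pi * N ^ 2) := by
      intro j _
      have e0 : vaalerNode N j * fejer N (x - j / N) =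
          (j / N - 1 / 2) * fejer N (x - j / N) + (if j = 0 then fejer N x else 0) := by
        unfold vaalerNode
        rcases eq_or_ne j 0 with rfl | hj
        · simp; ring
        · simp [hj]
      rw [e0, sineSum_eq (hne j), (sin_pi_mul_shift hN x j).1, (sin_pi_mul_shift hN x j).2,
        fejer_eq (hne j), (sin_pi_mul_shift hN x j).1, ← hS, ← hK]
      simp only [φ]
      have := hne j
      field_simp
      ring
    have h3 : sineSum N x / (Real.pi * N) = S ^ 2 / N ^ 2 * (N * Real.cot (Real.pi * x) / Real.pi) -
        N * (S * K / (Real.pi * N ^ 2)) := by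
      rw [sineSum_eq hx00, ← hS, ← hK]
      field_simp
    unfold vaaler
    rw [h3]
    have h4 := Finset.sum_congr rfl h2
    have h5 : ∑ j ∈ Finset.range N, (S ^ 2 / N ^ 2 * φ (x - (j : ℕ) / N) +
        (if j = 0 then fejer N x else 0)) =
        S ^ 2 / N ^ 2 * ∑ j ∈ Finset.range N, φ (x - (j : ℕ) / N) + fejer N x := by
      rw [Finset.sum_add_distrib, ← Finset.mul_sum, Finset.sum_ite_eq' (Finset.range N) 0,
        if_pos (Finset.mem_range.2 hN)]
    rw [Finset.sum_sub_distrib, Finset.sum_sub_distrib, h5, fejer_eq hx00, ← hS] at h4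
    simp only [Finset.sum_const, Finset.card_range, nsmul_eq_mul] at h4
    have e5 : S ^ 2 / ((N : ℝ) ^ 2 * Real.sin (Real.pi * x) ^ 2) =
      S ^ 2 / N ^ 2 * (1 / Real.sin (Real.pi * x) ^ 2) := by field_simp
    rw [e5] at h4
    linear_combination h4 - h1
  rw [← hshift] at hid
  have : 0 ≤ vaaler N x - (x - 1 / 2) := by
    rw [hid]
    refine mul_nonneg (by positivity) (by linarith)
  linarith

theorem le_vaaler {N : ℕ} (hN : 0 < N) {x : ℝ} (hx0 : 0 ≤ x) (hx1 : x ≤ 1) :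
    x - 1 / 2 ≤ vaaler N x := by
  have hN0 : (0 : ℝ) < N := by exact_mod_cast hN
  have hc : {x : ℝ | Real.sin (Real.pi * N * x) = 0}.Countable := by
    refine (Set.countable_range fun m : ℤ => (m : ℝ) / N).mono ?_
    intro y hy
    rw [Set.mem_ofPred_eq, Real.sin_eq_zero_iff] at hy
    obtain ⟨m, hm⟩ := hy
    refine ⟨m, ?_⟩
    have : Real.pi * m = Real.pi * (N * y) := by linarith
    have := mul_left_cancel₀ Real.pi_ne_zero this
    simp only
    rw [this]
    field_simp
  -- The excluded points form a countable set, so the inequality extends by continuity to the nodes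
  -- and to both endpoints.
  have h1 := (hc.dense_compl ℝ).open_subset_closure_inter (isOpen_Ioo (a := (0 : ℝ)) (b := 1))
  have h2 : x ∈ closure (Set.Ioo (0 : ℝ) 1) := by
    rw [closure_Ioo zero_ne_one]; exact ⟨hx0, hx1⟩
  have h3 := closure_minimal h1 isClosed_closure h2
  have hcl : IsClosed {x : ℝ | x - 1 / 2 ≤ vaaler N x} :=
    isClosed_le (by fun_prop) (continuous_vaaler N)
  refine closure_minimal ?_ hcl h3
  rintro y ⟨hy, hy'⟩
  exact vaaler_ge_of_sin_ne_zero hN hy.1 hy.2 hy'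

/-! ### Periodicity, means and Fourier coefficients of the majorant -/

theorem periodic_sin_two_pi_mul (j : ℕ) :
    Function.Periodic (fun x : ℝ => Real.sin (2 * Real.pi * j * x)) 1 := fun x => by
  simp only
  rw [show 2 * Real.pi * j * (x + 1) = 2 * Real.pi * j * x + j * (2 * Real.pi) by ring,
    Real.sin_add_nat_mul_two_pi]

theorem periodic_cos_two_pi_mul (j : ℕ) :
    Function.Periodic (fun x : ℝ => Real.cos (2 * Real.pi * j * x)) 1 := fun x => by
  simp only
  rw [show 2 * Real.pi * j * (x + 1) = 2 * Real.pi * j * x + j * (2 * Real.pi) by ring,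
    Real.cos_add_nat_mul_two_pi]

theorem periodic_sineSum (N : ℕ) : Function.Periodic (sineSum N) 1 := fun x => by
  unfold sineSum
  exact Finset.sum_congr rfl fun j _ => periodic_sin_two_pi_mul j x

theorem periodic_fejer (N : ℕ) : Function.Periodic (fejer N) 1 := fun x => by
  unfold fejer
  rw [Finset.sum_congr rfl fun j _ => periodic_sin_two_pi_mul j x,
    Finset.sum_congr rfl fun j _ => periodic_cos_two_pi_mul j x]

theorem periodic_vaaler (N : ℕ) : Function.Periodic (vaaler N) 1 := fun x => by
  unfold vaaler
  have h1 := periodic_fejer N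
  have h2 := periodic_sineSum N
  simp_rw [add_sub_right_comm x 1, h1 _, h2 _]

theorem periodic_expChar (h : ℤ) : Function.Periodic (expChar h) 1 := fun x => by
  have h3 : expChar h 1 = 1 := by simpa using expChar_mul_intCast h 1
  rw [expChar_add, h3, mul_one]

/-- The left side is the periodic sawtooth normalized to be `1/2` at the integers: `fract (-x)` is
`1 - fract x` elsewhere and `0` there. -/
theorem vaaler_ge {N : ℕ} (hN : 0 < N) (x : ℝ) : 1 / 2 - Int.fract (-x) ≤ vaaler N x := by
  have h1 := Int.fract_nonneg (-x)
  have h2 := (Int.fract_lt_one (-x)).le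
  have h := le_vaaler hN (x := 1 - Int.fract (-x)) (by linarith) (by linarith)
  have e : x = (1 - Int.fract (-x)) + ((-⌊-x⌋ - 1 : ℤ) : ℝ) * 1 := by
    push_cast
    have := Int.floor_add_fract (-x)
    linarith
  rw [e, (periodic_vaaler N).int_mul (-⌊-x⌋ - 1) (1 - Int.fract (-x)), ← e]
  linarith

theorem integral_comp_sub_of_periodic {E : Type*} [NormedAddCommGroup E] [NormedSpace ℝ E]
    {g : ℝ → E} (hg : Function.Periodic g 1) (t : ℝ) :
    ∫ x in (0 : ℝ)..1, g (x - t) = ∫ x in (0 : ℝ)..1, g x := by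
  rw [intervalIntegral.integral_comp_sub_right]
  have := hg.intervalIntegral_add_eq (0 - t) 0
  rw [zero_add] at this
  rw [← this]
  congr 1
  ring

theorem integral_comp_sub_left_of_periodic {E : Type*} [NormedAddCommGroup E] [NormedSpace ℝ E]
    {g : ℝ → E} (hg : Function.Periodic g 1) (t : ℝ) :
    ∫ x in (0 : ℝ)..1, g (t - x) = ∫ x in (0 : ℝ)..1, g x := by
  rw [intervalIntegral.integral_comp_sub_left]
  have := hg.intervalIntegral_add_eq (t - 1) 0
  rw [zero_add] at this
  rw [← this]
  congr 1
  ring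

theorem integral_fejer {N : ℕ} (hN : 0 < N) : ∫ x in (0 : ℝ)..1, fejer N x = 1 / N := by
  have hN0 : (N : ℝ) ≠ 0 := by exact_mod_cast hN.ne'
  have hc := continuous_fejer N
  have h : ∫ x in (0 : ℝ)..1, ∑ j ∈ Finset.range N, fejer N (x - j / N) = 1 := by
    simp_rw [sum_fejer hN]; simp
  rw [intervalIntegral.integral_finsetSum
    fun (j : ℕ) _ => (by fun_prop : Continuous fun x => fejer N (x - j / N)).intervalIntegrable
      _ _] at h
  simp_rw [integral_comp_sub_of_periodic (periodic_fejer N)] at h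
  rw [Finset.sum_const, Finset.card_range, nsmul_eq_mul] at h
  rw [eq_div_iff hN0, mul_comm, h]

theorem sineSum_neg (N : ℕ) (x : ℝ) : sineSum N (-x) = -sineSum N x := by
  unfold sineSum
  simp [Finset.sum_neg_distrib]

theorem integral_sineSum (N : ℕ) : ∫ x in (0 : ℝ)..1, sineSum N x = 0 := by
  have h := integral_comp_sub_left_of_periodic (periodic_sineSum N) 0
  simp_rw [zero_sub, sineSum_neg, intervalIntegral.integral_neg] at h
  linarith

theorem sum_vaalerNode {N : ℕ} (hN : 0 < N) : ∑ j ∈ Finset.range N, vaalerNode N j = 1 / 2 := by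
  have hN0 : (N : ℝ) ≠ 0 := by exact_mod_cast hN.ne'
  have h : ∀ j ∈ Finset.range N, vaalerNode N j = (j / N - 1 / 2) + (if j = 0 then 1 else 0) := by
    intro j _
    unfold vaalerNode
    split_ifs with h
    · subst h; norm_num
    · ring
  rw [Finset.sum_congr rfl h, Finset.sum_add_distrib, Finset.sum_ite_eq' (Finset.range N) 0,
    if_pos (Finset.mem_range.2 hN), Finset.sum_sub_distrib, ← Finset.sum_div]
  have h2 : (∑ j ∈ Finset.range N, (j : ℝ)) * 2 = N * (N - 1) := by
    have := Finset.sum_range_id_mul_two N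
    have h3 : ((N - 1 : ℕ) : ℝ) = N - 1 := by rw [Nat.cast_sub hN]; simp
    rw [← h3, ← Nat.cast_mul, ← this]
    push_cast
    rfl
  rw [show ∑ j ∈ Finset.range N, (j : ℝ) = N * (N - 1) / 2 by linarith]
  simp
  field_simp
  ring

theorem integral_vaaler {N : ℕ} (hN : 0 < N) : ∫ x in (0 : ℝ)..1, vaaler N x = 1 / (2 * N) := by
  have hc := continuous_fejer N
  have hs := continuous_sineSum N
  unfold vaaler
  rw [intervalIntegral.integral_sub ((by fun_prop : Continuous _).intervalIntegrable _ _)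
    ((by fun_prop : Continuous _).intervalIntegrable _ _),
    intervalIntegral.integral_finsetSum
      fun j _ => (by fun_prop : Continuous _).intervalIntegrable _ _]
  have h : ∀ j ∈ Finset.range N, ∫ x in (0 : ℝ)..1, (vaalerNode N j * fejer N (x - j / N) +
      sineSum N (x - j / N) / (Real.pi * N ^ 2)) = vaalerNode N j * (1 / N) := by
    intro j _
    rw [intervalIntegral.integral_add ((by fun_prop : Continuous _).intervalIntegrable _ _)
      ((by fun_prop : Continuous _).intervalIntegrable _ _), intervalIntegral.integral_const_mul,
      intervalIntegral.integral_div, integral_comp_sub_of_periodic (periodic_fejer N),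
      integral_comp_sub_of_periodic (periodic_sineSum N), integral_fejer hN, integral_sineSum]
    simp
  rw [Finset.sum_congr rfl h, ← Finset.sum_mul, sum_vaalerNode hN, intervalIntegral.integral_div,
    integral_sineSum]
  ring

theorem integral_expChar (h : ℤ) : ∫ x in (0 : ℝ)..1, expChar h x = if h = 0 then 1 else 0 := by
  split_ifs with h0
  · subst h0; simp [expChar_zero_left]
  · unfold expChar
    have hc : (2 * Real.pi * Complex.I * h : ℂ) ≠ 0 :=
      mul_ne_zero Complex.two_pi_I_ne_zero (by exact_mod_cast h0)
    rw [integral_exp_mul_complex hc]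
    have : Complex.exp (2 * Real.pi * Complex.I * h * ((1 : ℝ) : ℂ)) = 1 := by
      have := expChar_mul_intCast h 1
      simpa [expChar] using this
    rw [this]
    simp

theorem integral_linear_mul_expChar {h : ℤ} (h0 : h ≠ 0) :
    ∫ x in (0 : ℝ)..1, ((x - 1 / 2 : ℝ) : ℂ) * expChar h x = 1 / (2 * Real.pi * Complex.I * h) := by
  have hc : (2 * Real.pi * Complex.I * h : ℂ) ≠ 0 :=
    mul_ne_zero Complex.two_pi_I_ne_zero (by exact_mod_cast h0)
  have h1 : expChar h 1 = 1 := by simpa using expChar_mul_intCast h 1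
  have hd : ∀ x : ℝ, HasDerivAt (expChar h) (expChar h x * (2 * Real.pi * Complex.I * h)) x := by
    intro x
    unfold expChar
    have := ((Complex.ofRealCLM.hasDerivAt (x := x)).const_mul
      (2 * Real.pi * Complex.I * h : ℂ)).cexp
    simpa using this
  have hd2 : ∀ x : ℝ, HasDerivAt (fun x : ℝ => ((x - 1 / 2 : ℝ) : ℂ)) 1 x := by
    intro x
    have := ((hasDerivAt_id x).sub_const (1 / 2)).ofReal_comp
    simpa using this
  have hce := continuous_expChar h
  rw [intervalIntegral.integral_eq_sub_of_hasDerivAt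
    (f := fun x : ℝ => ((x - 1 / 2 : ℝ) : ℂ) * expChar h x / (2 * Real.pi * Complex.I * h) -
      expChar h x / (2 * Real.pi * Complex.I * h) ^ 2)]
  · simp only [h1, expChar_zero_right]
    push_cast
    ring
  · intro x _
    have := (((hd2 x).mul (hd x)).div_const (2 * Real.pi * Complex.I * h)).sub
      ((hd x).div_const ((2 * Real.pi * Complex.I * h) ^ 2))
    refine this.congr_deriv ?_
    field_simp
    ring
  · exact (by fun_prop : Continuous fun x : ℝ => ((x - 1 / 2 : ℝ) : ℂ) * expChar h x).intervalIntegrable _ _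

/-- The sawtooth contributes `1 / (2π|h|)`. The excess of the majorant is nonnegative, so its L¹
norm is its mean `1 / (2N)`, which bounds each of its coefficients. -/
theorem norm_integral_vaaler_mul_expChar_le {N : ℕ} (hN : 0 < N) {h : ℤ} (h0 : h ≠ 0) :
    ‖∫ x in (0 : ℝ)..1, (vaaler N x : ℂ) * expChar h x‖ ≤
      1 / (2 * Real.pi * |(h : ℝ)|) + 1 / (2 * N) := by
  have hv := continuous_vaaler N
  have hce := continuous_expChar h
  have e : ∫ x in (0 : ℝ)..1, (vaaler N x : ℂ) * expChar h x =
      (∫ x in (0 : ℝ)..1, ((x - 1 / 2 : ℝ) : ℂ) * expChar h x) +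
      ∫ x in (0 : ℝ)..1, ((vaaler N x - (x - 1 / 2) : ℝ) : ℂ) * expChar h x := by
    rw [← intervalIntegral.integral_add ((by fun_prop : Continuous _).intervalIntegrable _ _)
      ((by fun_prop : Continuous _).intervalIntegrable _ _)]
    congr 1
    ext x
    push_cast
    ring
  rw [e, integral_linear_mul_expChar h0]
  refine (norm_add_le _ _).trans (add_le_add (le_of_eq ?_) ?_)
  · rw [norm_div, norm_mul, norm_mul, norm_mul]
    simp [Complex.norm_real, abs_of_pos Real.pi_pos]
  · refine (intervalIntegral.norm_integral_le_integral_norm zero_le_one).trans (le_of_eq ?_)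
    have h1 : ∫ x in (0 : ℝ)..1, ‖((vaaler N x - (x - 1 / 2) : ℝ) : ℂ) * expChar h x‖ =
        ∫ x in (0 : ℝ)..1, (vaaler N x - (x - 1 / 2)) := by
      refine intervalIntegral.integral_congr fun x hx => ?_
      rw [Set.uIcc_of_le zero_le_one] at hx
      have := le_vaaler hN hx.1 hx.2
      rw [norm_mul, norm_expChar, mul_one, Complex.norm_real, Real.norm_of_nonneg (by linarith)]
    rw [h1, intervalIntegral.integral_sub (hv.intervalIntegrable _ _)
      ((by fun_prop : Continuous _).intervalIntegrable _ _), integral_vaaler hN,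
      intervalIntegral.integral_sub ((by fun_prop : Continuous _).intervalIntegrable _ _)
      ((by fun_prop : Continuous _).intervalIntegrable _ _)]
    simp

/-! ### The space of trigonometric polynomials -/

/-- Trigonometric polynomials of degree less than `N`. -/
noncomputable def trigPoly (N : ℕ) : Submodule ℂ (ℝ → ℂ) :=
  Submodule.span ℂ (expChar '' (Finset.Ioo (-(N : ℤ)) N : Finset ℤ))

theorem expChar_mem_trigPoly {N : ℕ} {h : ℤ} (hh : |h| < N) : expChar h ∈ trigPoly N := by
  refine Submodule.subset_span ⟨h, ?_, rfl⟩
  rw [Finset.coe_Ioo]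
  exact abs_lt.1 hh

theorem comp_sub_mem_trigPoly {N : ℕ} {g : ℝ → ℂ} (hg : g ∈ trigPoly N) (t : ℝ) :
    (fun x => g (x - t)) ∈ trigPoly N := by
  induction hg using Submodule.span_induction with
  | mem g hg =>
    obtain ⟨h, hh, rfl⟩ := hg
    rw [Finset.coe_Ioo] at hh
    have : (fun x => expChar h (x - t)) = expChar h (-t) • expChar h := by
      ext x
      rw [sub_eq_add_neg, expChar_add, Pi.smul_apply, smul_eq_mul, mul_comm]
    rw [this]
    exact Submodule.smul_mem _ _ (expChar_mem_trigPoly (abs_lt.2 hh))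
  | zero => exact Submodule.zero_mem _
  | add g k _ _ h1 h2 => exact Submodule.add_mem _ h1 h2
  | smul c g _ h1 => exact Submodule.smul_mem _ c h1

theorem comp_neg_mem_trigPoly {N : ℕ} {g : ℝ → ℂ} (hg : g ∈ trigPoly N) :
    (fun x => g (-x)) ∈ trigPoly N := by
  induction hg using Submodule.span_induction with
  | mem g hg =>
    obtain ⟨h, hh, rfl⟩ := hg
    rw [Finset.coe_Ioo] at hh
    have : (fun x => expChar h (-x)) = expChar (-h) := by
      ext x
      rw [expChar_neg_right]
    rw [this]
    exact expChar_mem_trigPoly (by rw [abs_neg]; exact abs_lt.2 hh)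
  | zero => exact Submodule.zero_mem _
  | add g k _ _ h1 h2 => exact Submodule.add_mem _ h1 h2
  | smul c g _ h1 => exact Submodule.smul_mem _ c h1

theorem fejer_mem_trigPoly (N : ℕ) : (fun x => (fejer N x : ℂ)) ∈ trigPoly N := by
  have : (fun x => (fejer N x : ℂ)) = ((N : ℂ) ^ 2)⁻¹ •
      ∑ i ∈ Finset.range N, ∑ l ∈ Finset.range N, expChar ((i : ℤ) - l) := by
    ext x
    rw [fejer_eq_sum, Pi.smul_apply, smul_eq_mul, Finset.sum_apply, div_eq_inv_mul]
    simp_rw [Finset.sum_apply]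
  rw [this]
  refine Submodule.smul_mem _ _ (Submodule.sum_mem _ fun i hi => Submodule.sum_mem _ fun l hl => ?_)
  rw [Finset.mem_range] at hi hl
  exact expChar_mem_trigPoly (by rw [abs_lt]; omega)

theorem sineSum_mem_trigPoly (N : ℕ) : (fun x => (sineSum N x : ℂ)) ∈ trigPoly N := by
  have : (fun x => (sineSum N x : ℂ)) = ∑ j ∈ Finset.range N,
      (2 * Complex.I)⁻¹ • (expChar (j : ℤ) - expChar (-(j : ℤ))) := by
    ext x
    rw [Finset.sum_apply]
    unfold sineSum
    rw [Complex.ofReal_sum]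
    refine Finset.sum_congr rfl fun j _ => ?_
    rw [Pi.smul_apply, Pi.sub_apply, expChar_eq, expChar_eq, smul_eq_mul]
    have hI := Complex.I_ne_zero
    push_cast
    simp only [mul_neg, neg_mul, Complex.cos_neg, Complex.sin_neg]
    field_simp
    ring
  rw [this]
  refine Submodule.sum_mem _ fun j hj => Submodule.smul_mem _ _ (Submodule.sub_mem _ ?_ ?_)
  · rw [Finset.mem_range] at hj
    exact expChar_mem_trigPoly (by rw [abs_lt]; omega)
  · rw [Finset.mem_range] at hj
    exact expChar_mem_trigPoly (by rw [abs_lt]; omega)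

theorem vaaler_mem_trigPoly (N : ℕ) : (fun x => (vaaler N x : ℂ)) ∈ trigPoly N := by
  have : (fun x => (vaaler N x : ℂ)) = ∑ j ∈ Finset.range N,
      ((vaalerNode N j : ℂ) • (fun x => (fejer N (x - (j / N : ℝ)) : ℂ)) +
        (Real.pi * (N : ℂ) ^ 2)⁻¹ • fun x => (sineSum N (x - (j / N : ℝ)) : ℂ)) -
      (Real.pi * (N : ℂ))⁻¹ • fun x => (sineSum N x : ℂ) := by
    ext x
    unfold vaaler
    rw [Pi.sub_apply, Finset.sum_apply]
    push_cast
    simp only [Pi.add_apply, Pi.smul_apply, smul_eq_mul]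
    simp only [div_eq_inv_mul]
  rw [this]
  refine Submodule.sub_mem _ (Submodule.sum_mem _ fun j _ => Submodule.add_mem _ ?_ ?_) ?_
  · exact Submodule.smul_mem _ _ (comp_sub_mem_trigPoly (fejer_mem_trigPoly N) _)
  · exact Submodule.smul_mem _ _ (comp_sub_mem_trigPoly (sineSum_mem_trigPoly N) _)
  · exact Submodule.smul_mem _ _ (sineSum_mem_trigPoly N)

/-- Orthogonality recovers the coefficients as integrals, so integral bounds suffice and no explicit
formula for the coefficients is needed. -/
theorem exists_coeff_of_mem_trigPoly {N : ℕ} {g : ℝ → ℂ} (hg : g ∈ trigPoly N) :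
    ∃ c : ℤ → ℂ, (∀ x, g x = ∑ h ∈ Finset.Ioo (-(N : ℤ)) N, c h * expChar h x) ∧
      ∀ h ∈ Finset.Ioo (-(N : ℤ)) N, c h = ∫ x in (0 : ℝ)..1, g x * expChar (-h) x := by
  unfold trigPoly at hg
  rw [Submodule.mem_span_image_finset_iff_exists_fun] at hg
  obtain ⟨c', rfl⟩ := hg
  let c : ℤ → ℂ := fun h => if hh : h ∈ Finset.Ioo (-(N : ℤ)) N then c' ⟨h, hh⟩ else 0
  have h1 : ∀ x, (∑ h : Finset.Ioo (-(N : ℤ)) N, c' h • expChar h) x =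
      ∑ h ∈ Finset.Ioo (-(N : ℤ)) N, c h * expChar h x := fun x => by
    rw [Finset.sum_apply, ← Finset.sum_coe_sort (Finset.Ioo (-(N : ℤ)) N)
      (fun h => c h * expChar h x)]
    refine Finset.sum_congr rfl fun h _ => ?_
    simp only [c, dif_pos h.2, Pi.smul_apply, smul_eq_mul]
  refine ⟨c, h1, fun h hh => ?_⟩
  simp_rw [h1, Finset.sum_mul, mul_assoc, ← expChar_add_left]
  rw [intervalIntegral.integral_finsetSum fun l _ => by
    have := continuous_expChar (l + -h)
    exact (by fun_prop : Continuous _).intervalIntegrable _ _]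
  simp_rw [intervalIntegral.integral_const_mul, integral_expChar]
  rw [Finset.sum_eq_single_of_mem h hh]
  · simp
  · intro l _ hl
    rw [if_neg (by omega), mul_zero]

/-! ### Selberg's majorant of an arc -/

/-- The Selberg majorant of the indicator function of an arc. -/
noncomputable def selberg (N : ℕ) (a b x : ℝ) : ℝ := (b - a) + vaaler N (x - b) + vaaler N (a - x)

/-- With the sawtooth in place of `vaaler`, the expression is the integer `1 + ⌊b - x⌋ + ⌊x - a⌋`.
Since `b - x` and `x - a` have nonnegative sum, their floors sum to more than `-2`, hence to at
least `-1`. -/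
theorem selberg_nonneg {N : ℕ} (hN : 0 < N) {a b : ℝ} (hab : a ≤ b) (x : ℝ) :
    0 ≤ selberg N a b x := by
  have h1 := vaaler_ge hN (x - b)
  have h2 := vaaler_ge hN (a - x)
  rw [neg_sub] at h1 h2
  unfold selberg
  have h3 := Int.fract_lt_one (b - x)
  have h4 := Int.fract_lt_one (x - a)
  have h5 : ⌊b - x⌋ + ⌊x - a⌋ ≥ -1 := by
    have e1 := Int.floor_add_fract (b - x)
    have e2 := Int.floor_add_fract (x - a)
    have : (-2 : ℝ) < ((⌊b - x⌋ + ⌊x - a⌋ : ℤ) : ℝ) := by push_cast; linarith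
    have : (-2 : ℤ) < ⌊b - x⌋ + ⌊x - a⌋ := by exact_mod_cast this
    omega
  have h6 : (-1 : ℝ) ≤ ⌊b - x⌋ + ⌊x - a⌋ := by exact_mod_cast h5
  have e1 := Int.floor_add_fract (b - x)
  have e2 := Int.floor_add_fract (x - a)
  linarith

theorem one_le_selberg {N : ℕ} (hN : 0 < N) {a b x : ℝ} (hx : x ∈ Set.Ico a b) :
    1 ≤ selberg N a b x := by
  have h1 := vaaler_ge hN (x - b)
  have h2 := vaaler_ge hN (a - x)
  rw [neg_sub] at h1 h2
  unfold selberg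
  have fr {t : ℝ} (ht : 0 ≤ t) : Int.fract t ≤ t := by
    have : (0 : ℝ) ≤ ⌊t⌋ := by exact_mod_cast Int.floor_nonneg.2 ht
    have := Int.floor_add_fract t
    linarith
  have h3 := fr (sub_nonneg.2 hx.2.le)
  have h4 := fr (sub_nonneg.2 hx.1)
  linarith

theorem selberg_mem_trigPoly {N : ℕ} (hN : 0 < N) (a b : ℝ) :
    (fun x => (selberg N a b x : ℂ)) ∈ trigPoly N := by
  have hv := vaaler_mem_trigPoly N
  have : (fun x => (selberg N a b x : ℂ)) = ((b - a : ℝ) : ℂ) • expChar 0 +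
      (fun x => (vaaler N (x - b) : ℂ)) + fun x => (vaaler N (-(x - a)) : ℂ) := by
    ext x
    simp only [Pi.add_apply, Pi.smul_apply, smul_eq_mul, expChar_zero_left]
    unfold selberg
    rw [neg_sub]
    push_cast
    ring
  rw [this]
  refine Submodule.add_mem _ (Submodule.add_mem _ ?_ (comp_sub_mem_trigPoly hv b)) ?_
  · exact Submodule.smul_mem _ _ (expChar_mem_trigPoly (by simpa using hN))
  · exact comp_sub_mem_trigPoly (comp_neg_mem_trigPoly hv) a

theorem integral_selberg {N : ℕ} (hN : 0 < N) (a b : ℝ) :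
    ∫ x in (0 : ℝ)..1, selberg N a b x = b - a + 1 / N := by
  have hv := continuous_vaaler N
  unfold selberg
  rw [intervalIntegral.integral_add ((by fun_prop : Continuous _).intervalIntegrable _ _)
    ((by fun_prop : Continuous _).intervalIntegrable _ _), intervalIntegral.integral_add
    ((by fun_prop : Continuous _).intervalIntegrable _ _)
    ((by fun_prop : Continuous _).intervalIntegrable _ _),
    integral_comp_sub_of_periodic (periodic_vaaler N),
    integral_comp_sub_left_of_periodic (periodic_vaaler N), integral_vaaler hN]
  simp
  ring

/-- The constant term drops out and each sawtooth majorant contributes `1/(2π|h|) + 1/(2N)`. With `π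
> 3` and `N > |h|` the total is at most `2 (1/6 + 1/2) / |h|`. -/
theorem norm_integral_selberg_mul_expChar_le {N : ℕ} (hN : 0 < N) (a b : ℝ) {h : ℤ} (h0 : h ≠ 0)
    (hh : |h| < N) :
    ‖∫ x in (0 : ℝ)..1, (selberg N a b x : ℂ) * expChar h x‖ ≤ 4 / 3 / |(h : ℝ)| := by
  have hv := continuous_vaaler N
  have hce := continuous_expChar h
  have hce' := continuous_expChar (-h)
  have e1 : ∫ x in (0 : ℝ)..1, (vaaler N (x - b) : ℂ) * expChar h x =
      expChar h b * ∫ x in (0 : ℝ)..1, (vaaler N x : ℂ) * expChar h x := by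
    rw [← integral_comp_sub_of_periodic (g := fun x => (vaaler N x : ℂ) * expChar h x)
      (fun x => by simp only [periodic_vaaler N x, periodic_expChar h x]) b,
      ← intervalIntegral.integral_const_mul]
    congr 1
    ext x
    rw [mul_left_comm, ← expChar_add, add_sub_cancel]
  have e2 : ∫ x in (0 : ℝ)..1, (vaaler N (a - x) : ℂ) * expChar h x =
      expChar h a * ∫ x in (0 : ℝ)..1, (vaaler N x : ℂ) * expChar (-h) x := by
    rw [← integral_comp_sub_left_of_periodic (g := fun x => (vaaler N x : ℂ) * expChar (-h) x)
      (fun x => by simp only [periodic_vaaler N x, periodic_expChar (-h) x]) a,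
      ← intervalIntegral.integral_const_mul]
    congr 1
    ext x
    rw [mul_left_comm, ← expChar_neg_right, ← expChar_add]
    ring_nf
  have e3 : ∫ x in (0 : ℝ)..1, (selberg N a b x : ℂ) * expChar h x =
      expChar h b * (∫ x in (0 : ℝ)..1, (vaaler N x : ℂ) * expChar h x) +
      expChar h a * ∫ x in (0 : ℝ)..1, (vaaler N x : ℂ) * expChar (-h) x := by
    rw [← e1, ← e2, ← intervalIntegral.integral_add
      ((by fun_prop : Continuous _).intervalIntegrable _ _)
      ((by fun_prop : Continuous _).intervalIntegrable _ _)]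
    have : ∫ x in (0 : ℝ)..1, ((b - a : ℝ) : ℂ) * expChar h x = 0 := by
      rw [intervalIntegral.integral_const_mul, integral_expChar, if_neg h0, mul_zero]
    rw [← zero_add (∫ x in (0 : ℝ)..1, _ + _), ← this, ← intervalIntegral.integral_add
      ((by fun_prop : Continuous _).intervalIntegrable _ _)
      ((by fun_prop : Continuous _).intervalIntegrable _ _)]
    congr 1
    ext x
    unfold selberg
    push_cast
    ring
  rw [e3]
  have b1 := norm_integral_vaaler_mul_expChar_le hN h0
  have b2 := norm_integral_vaaler_mul_expChar_le hN (neg_ne_zero.2 h0)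
  rw [Int.cast_neg, abs_neg] at b2
  refine (norm_add_le _ _).trans ?_
  rw [norm_mul, norm_mul, norm_expChar, norm_expChar, one_mul, one_mul]
  have hpos : 0 < |(h : ℝ)| := abs_pos.2 (by exact_mod_cast h0)
  have hlt : |(h : ℝ)| ≤ N := by exact_mod_cast hh.le
  have b3 : 1 / (2 * (N : ℝ)) ≤ 1 / (2 * |(h : ℝ)|) :=
    one_div_le_one_div_of_le (by positivity) (by linarith)
  have b4 : 1 / (2 * Real.pi * |(h : ℝ)|) ≤ 1 / (6 * |(h : ℝ)|) :=
    one_div_le_one_div_of_le (by positivity) (by nlinarith [Real.pi_gt_three])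
  have e4 : 4 / 3 / |(h : ℝ)| = 2 * (1 / (6 * |(h : ℝ)|) + 1 / (2 * |(h : ℝ)|)) := by
    field_simp; norm_num
  linarith

/-- The coefficients of the Selberg majorant of degree less than `N`. -/
theorem exists_selberg_coeff {N : ℕ} (hN : 0 < N) {a b : ℝ} (hab : a ≤ b) :
    ∃ c : ℤ → ℂ, (∀ x, (selberg N a b x : ℂ) = ∑ h ∈ Finset.Ioo (-(N : ℤ)) N, c h * expChar h x) ∧
      c 0 = ((b - a + 1 / N : ℝ) : ℂ) ∧
      (∀ h ∈ Finset.Ioo (-(N : ℤ)) N, ‖c h‖ ≤ b - a + 1 / N) ∧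
      ∀ h ∈ Finset.Ioo (-(N : ℤ)) N, h ≠ 0 → ‖c h‖ ≤ 4 / 3 / |(h : ℝ)| := by
  obtain ⟨c, hc, hc'⟩ := exists_coeff_of_mem_trigPoly (selberg_mem_trigPoly hN a b)
  refine ⟨c, hc, ?_, fun h hh => ?_, fun h hh h0 => ?_⟩
  · rw [hc' 0 (by simp [hN]), ← integral_selberg hN, ← intervalIntegral.integral_ofReal]
    simp [expChar_zero_left]
  -- The coefficients of a nonnegative function are bounded by its mean.
  · rw [hc' h hh, ← integral_selberg hN]
    refine (intervalIntegral.norm_integral_le_integral_norm zero_le_one).trans (le_of_eq ?_)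
    congr 1
    ext x
    rw [norm_mul, norm_expChar, mul_one, Complex.norm_real, Real.norm_of_nonneg
      (selberg_nonneg hN hab x)]
  · rw [hc' h hh]
    have h1 := norm_integral_selberg_mul_expChar_le hN a b (neg_ne_zero.2 h0)
      (by rw [abs_neg]; exact abs_lt.2 (Finset.mem_Ioo.1 hh))
    rwa [Int.cast_neg, abs_neg] at h1

/-! ### Arcs and boxes -/

/-- The image of `[a, b)` in the circle. -/
def arc (a b : ℝ) : Set UnitAddCircle := (fun x : ℝ => (x : UnitAddCircle)) '' Set.Ico a b

theorem mem_arc_iff {a b : ℝ} (hb : b ≤ a + 1) (y : UnitAddCircle) :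
    y ∈ arc a b ↔ (AddCircle.equivIco 1 a y : ℝ) < b := by
  constructor
  · rintro ⟨x, hx, rfl⟩
    have := AddCircle.equivIco_coe_eq (p := (1 : ℝ)) (a := a) ⟨hx.1, hx.2.trans_le hb⟩
    simp only
    rw [this]
    exact hx.2
  · intro h
    exact ⟨AddCircle.equivIco 1 a y, ⟨(AddCircle.equivIco 1 a y).2.1, h⟩, AddCircle.coe_equivIco⟩

theorem mem_arc_compl_iff {a b : ℝ} (hab : a ≤ b) (y : UnitAddCircle) :
    y ∈ arc b (a + 1) ↔ b ≤ (AddCircle.equivIco 1 a y : ℝ) := by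
  constructor
  · rintro ⟨x, hx, rfl⟩
    have := AddCircle.equivIco_coe_eq (p := (1 : ℝ)) (a := a) ⟨hab.trans hx.1, hx.2⟩
    simp only
    rw [this]
    exact hx.1
  · intro h
    exact ⟨AddCircle.equivIco 1 a y, ⟨h, (AddCircle.equivIco 1 a y).2.2⟩, AddCircle.coe_equivIco⟩

theorem compl_arc {a b : ℝ} (hab : a ≤ b) (hb : b ≤ a + 1) : (arc a b)ᶜ = arc b (a + 1) := by
  ext y
  rw [Set.mem_compl_iff, mem_arc_iff hb, mem_arc_compl_iff hab, not_lt]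

theorem measurableSet_arc {a b : ℝ} (hb : b ≤ a + 1) : MeasurableSet (arc a b) := by
  have h : arc a b = AddCircle.measurableEquivIco 1 a ⁻¹' {y | (y : ℝ) < b} := by
    ext y
    exact mem_arc_iff hb y
  rw [h]
  exact (AddCircle.measurableEquivIco 1 a).measurable
    (measurableSet_lt measurable_subtype_coe measurable_const)

theorem volume_real_arc {a b : ℝ} (hab : a ≤ b) (hb : b ≤ a + 1) :
    (volume : Measure UnitAddCircle).real (arc a b) = b - a := by
  have hm := measurableSet_arc hb
  have hpre := (UnitAddCircle.measurePreserving_mk a).measure_preimage hm.nullMeasurableSet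
  rw [Measure.restrict_apply ((UnitAddCircle.measurePreserving_mk a).measurable hm)] at hpre
  have hmem : ∀ x ∈ Set.Ioo a (a + 1), (x : UnitAddCircle) ∈ arc a b ↔ x < b := by
    intro x hx
    rw [mem_arc_iff hb, AddCircle.equivIco_coe_eq (p := (1 : ℝ)) ⟨hx.1.le, hx.2⟩]
  -- The fundamental domain is `(a, a + 1]`, where the endpoint `a` of the arc is represented by `a
  -- + 1`; the arc therefore pulls back to `(a, b)` up to a null set.
  have h1 : volume (Set.Ioo a b) ≤ volume (arc a b) := by
    rw [← hpre]
    refine measure_mono fun x hx => ⟨?_, hx.1, (hx.2.trans_le hb).le⟩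
    exact (hmem x ⟨hx.1, hx.2.trans_le hb⟩).2 hx.2
  have h2 : volume (arc a b) ≤ volume (Set.Ioo a b) + volume {a + 1} := by
    rw [← hpre]
    refine (measure_mono (t := Set.Ioo a b ∪ {a + 1}) ?_).trans (measure_union_le _ _)
    rintro x ⟨hx, hx'⟩
    rcases hx'.2.lt_or_eq with h | h
    · exact Or.inl ⟨hx'.1, (hmem x ⟨hx'.1, h⟩).1 hx⟩
    · exact Or.inr h
  rw [Real.volume_singleton, add_zero] at h2
  rw [Measure.real, le_antisymm h2 h1, Real.volume_Ioo, ENNReal.toReal_ofReal (by linarith)]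

/-- Half-open arcs of the circle, of length at most `1`. -/
def IsArc (J : Set UnitAddCircle) : Prop := ∃ a b : ℝ, a ≤ b ∧ b ≤ a + 1 ∧ J = arc a b

theorem IsArc.compl {J : Set UnitAddCircle} (hJ : IsArc J) : IsArc Jᶜ := by
  obtain ⟨a, b, hab, hb, rfl⟩ := hJ
  exact ⟨b, a + 1, hb, by linarith, compl_arc hab hb⟩

theorem isArc_univ : IsArc Set.univ := by
  refine ⟨0, 0 + 1, by norm_num, by norm_num, ?_⟩
  rw [← compl_arc le_rfl (by norm_num)]
  simp [arc]

theorem IsArc.measurableSet {J : Set UnitAddCircle} (hJ : IsArc J) : MeasurableSet J := by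
  obtain ⟨a, b, hab, hb, rfl⟩ := hJ
  exact measurableSet_arc hb

theorem box_eq_pi {d : ℕ} (a b : Fin d → ℝ) : box a b = Set.univ.pi fun i => arc (a i) (b i) := by
  ext y
  constructor
  · rintro ⟨x, hx, rfl⟩ i _
    exact ⟨x i, hx i (Set.mem_univ i), rfl⟩
  · intro hy
    choose x hx hxy using fun i => hy i (Set.mem_univ i)
    exact ⟨x, fun i _ => hx i, funext hxy⟩

theorem volume_real_pi {d : ℕ} (J : Fin d → Set UnitAddCircle) :
    (volume : Measure (Torus d)).real (Set.univ.pi J) =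
      ∏ i, (volume : Measure UnitAddCircle).real (J i) := by
  rw [Measure.real, volume_pi, Measure.pi_pi, ENNReal.toReal_prod]
  rfl

theorem volume_real_univ (d : ℕ) : (volume : Measure (Torus d)).real Set.univ = 1 := by
  have h : (volume : Measure UnitAddCircle).real Set.univ = 1 := by
    rw [Measure.real, AddCircle.measure_univ, ENNReal.ofReal_one, ENNReal.toReal_one]
  rw [← Set.pi_univ Set.univ, volume_real_pi]
  exact Finset.prod_eq_one fun i _ => h

/-! ### The Erdős–Turán–Koksma inequality -/

/-- The character of the torus with frequency `h`. -/
noncomputable def torusChar {d : ℕ} (h : Fin d → ℤ) (x : Torus d) : ℂ :=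
  ∏ i, (fourier (h i) (x i) : ℂ)

theorem continuous_torusChar {d : ℕ} (h : Fin d → ℤ) : Continuous (torusChar h) := by
  unfold torusChar
  fun_prop

theorem norm_torusChar {d : ℕ} (h : Fin d → ℤ) (x : Torus d) : ‖torusChar h x‖ = 1 := by
  unfold torusChar
  rw [norm_prod]
  exact Finset.prod_eq_one fun i _ => Circle.norm_coe _

theorem fourier_coe_eq_expChar (h : ℤ) (x : ℝ) :
    (fourier h (x : UnitAddCircle) : ℂ) = expChar h x := by
  rw [fourier_coe_apply]
  simp [expChar]

theorem integrable_torusChar {d : ℕ} (P : Measure (Torus d)) [IsFiniteMeasure P] (h : Fin d → ℤ) :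
    Integrable (torusChar h) P := by
  refine Integrable.of_bound (continuous_torusChar h).aestronglyMeasurable 1 ?_
  exact Filter.Eventually.of_forall fun x => (norm_torusChar h x).le

/-- Expanded, the difference has nonnegative coefficients in the `l i`, so it is largest when all of
them are `1`. It measures the loss from the surplus `1/N` in the mean of each majorant. -/
theorem prod_add_sub_prod_le {ι : Type*} (s : Finset ι) (l : ι → ℝ) (x : ℝ) (hx : 0 ≤ x)
    (h0 : ∀ i, 0 ≤ l i) (h1 : ∀ i, l i ≤ 1) :
    ∏ i ∈ s, (l i + x) - ∏ i ∈ s, l i ≤ (1 + x) ^ s.card - 1 := by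
  classical
  induction s using Finset.induction_on with
  | empty => simp
  | insert i s hi ih =>
    rw [Finset.prod_insert hi, Finset.prod_insert hi, Finset.card_insert_of_notMem hi, pow_succ]
    have hA : ∏ i ∈ s, (l i + x) ≤ (1 + x) ^ s.card := by
      refine (Finset.prod_le_prod (fun i _ => add_nonneg (h0 i) hx)
        (fun i _ => add_le_add_left (h1 i) x)).trans (le_of_eq ?_)
      rw [Finset.prod_const]
    have hB : ∏ i ∈ s, l i ≤ ∏ i ∈ s, (l i + x) :=
      Finset.prod_le_prod (fun i _ => h0 i) (fun i _ => by linarith)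
    nlinarith [h0 i, h1 i, mul_nonneg (sub_nonneg.2 (h1 i)) (sub_nonneg.2 hB),
      mul_nonneg hx (sub_nonneg.2 hA)]

/-- The frequencies of sup norm less than `N`. -/
noncomputable def frequencies (d N : ℕ) : Finset (Fin d → ℤ) :=
  Fintype.piFinset fun _ => Finset.Ioo (-(N : ℤ)) N

/-- The Fourier part of the Erdős–Turán–Koksma bound. -/
noncomputable def fourierError {d : ℕ} (P : Measure (Torus d)) (N : ℕ) : ℝ :=
  ∑ h ∈ (frequencies d N).erase 0, ‖∫ x, torusChar h x ∂P‖ / ‖h‖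

/-- Decay is used only in a coordinate where `|h i|` equals `‖h‖`; the other factors are bounded by
`L`. -/
theorem norm_prod_coeff_le {d N : ℕ} {c : Fin d → ℤ → ℂ} {L : ℝ}
    (hc : ∀ i, ∀ h ∈ Finset.Ioo (-(N : ℤ)) N, ‖c i h‖ ≤ L)
    (hc' : ∀ i, ∀ h ∈ Finset.Ioo (-(N : ℤ)) N, h ≠ 0 → ‖c i h‖ ≤ 4 / 3 / |(h : ℝ)|)
    {h : Fin d → ℤ} (hh : h ∈ (frequencies d N).erase 0) :
    ‖∏ i, c i (h i)‖ ≤ L ^ (d - 1) * (4 / 3) / ‖h‖ := by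
  rw [Finset.mem_erase, frequencies, Fintype.mem_piFinset] at hh
  obtain ⟨h0, hmem⟩ := hh
  obtain ⟨j, hj⟩ := Function.ne_iff.1 h0
  obtain ⟨i, -, hi⟩ := Finset.exists_max_image Finset.univ (fun i => ‖h i‖) ⟨j, Finset.mem_univ j⟩
  have hnorm : ‖h‖ ≤ ‖h i‖ :=
    (pi_norm_le_iff_of_nonneg (norm_nonneg _)).2 fun k => hi k (Finset.mem_univ k)
  have hpos : 0 < ‖h‖ := norm_pos_iff.2 h0
  have hi0 : h i ≠ 0 := norm_pos_iff.1 (hpos.trans_le hnorm)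
  have hL : 0 ≤ L := (norm_nonneg _).trans (hc i _ (hmem i))
  rw [norm_prod, ← Finset.mul_prod_erase _ _ (Finset.mem_univ i)]
  have h1 : ‖c i (h i)‖ ≤ 4 / 3 / ‖h‖ := by
    refine (hc' i _ (hmem i) hi0).trans ?_
    rw [Int.norm_eq_abs] at hnorm
    exact div_le_div_of_nonneg_left (by norm_num) hpos hnorm
  have h2 : ∏ k ∈ Finset.univ.erase i, ‖c k (h k)‖ ≤ L ^ (d - 1) := by
    refine (Finset.prod_le_prod (fun k _ => norm_nonneg _) (fun k _ => hc k _ (hmem k))).trans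
      (le_of_eq ?_)
    rw [Finset.prod_const, Finset.card_erase_of_mem (Finset.mem_univ i), Finset.card_univ,
      Fintype.card_fin]
  refine (mul_le_mul h1 h2 (Finset.prod_nonneg fun k _ => norm_nonneg _) (by positivity)).trans
    (le_of_eq ?_)
  ring

/-- The product of the nonnegative Selberg majorants dominates the indicator of the box. Integrating
its Fourier expansion against `P`, the zero frequency gives nearly the volume and the others give
`fourierError`. -/
theorem measureReal_pi_le {d N : ℕ} (hN : 0 < N) (P : Measure (Torus d)) [IsProbabilityMeasure P]
    {J : Fin d → Set UnitAddCircle} (hJ : ∀ i, IsArc (J i)) :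
    P.real (Set.univ.pi J) ≤ (volume : Measure (Torus d)).real (Set.univ.pi J) +
      ((1 + 1 / N) ^ d - 1 + (1 + 1 / N : ℝ) ^ (d - 1) * (4 / 3) * fourierError P N) := by
  choose a b hab hb hJab using hJ
  choose c hc hc0 hcL hc' using fun i => exists_selberg_coeff hN (hab i)
  have hN1 : (0 : ℝ) ≤ 1 / N := by positivity
  let F : Torus d → ℂ := fun x => ∑ h ∈ frequencies d N, (∏ i, c i (h i)) * torusChar h x
  have hF : ∀ y : Fin d → ℝ, F (toTorus y) = ((∏ i, selberg N (a i) (b i) (y i) : ℝ) : ℂ) := by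
    intro y
    push_cast
    simp_rw [hc]
    rw [Finset.prod_univ_sum]
    refine Finset.sum_congr rfl fun h _ => ?_
    rw [Finset.prod_mul_distrib]
    congr 1
    refine Finset.prod_congr rfl fun i _ => ?_
    exact fourier_coe_eq_expChar (h i) (y i)
  have hsurj : ∀ x : Torus d, ∃ y : Fin d → ℝ, toTorus y = x := fun x => by
    choose y hy using fun i => QuotientAddGroup.mk_surjective (x i)
    exact ⟨y, funext hy⟩
  have hFint : Integrable F P :=
    integrable_finsetSum _ fun h _ => (integrable_torusChar P h).const_mul _
  have hge : ∀ x, Set.indicator (Set.univ.pi J) (fun _ => (1 : ℝ)) x ≤ (F x).re := by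
    intro x
    by_cases hx : x ∈ Set.univ.pi J
    · rw [Set.indicator_of_mem hx]
      have : ∀ i, ∃ y ∈ Set.Ico (a i) (b i), (y : UnitAddCircle) = x i := fun i => by
        have := hx i (Set.mem_univ i)
        rwa [hJab i] at this
      choose y hy hyx using this
      have e : x = toTorus y := funext fun i => (hyx i).symm
      rw [e, hF, Complex.ofReal_re]
      simpa using Finset.prod_le_prod (s := Finset.univ) (f := fun _ : Fin d => (1 : ℝ))
        (fun i _ => zero_le_one) (fun i _ => one_le_selberg hN (hy i))
    · rw [Set.indicator_of_notMem hx]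
      obtain ⟨y, rfl⟩ := hsurj x
      rw [hF, Complex.ofReal_re]
      exact Finset.prod_nonneg fun i _ => selberg_nonneg hN (hab i) _
  have hmeas : MeasurableSet (Set.univ.pi J) :=
    MeasurableSet.univ_pi fun i => by rw [hJab i]; exact measurableSet_arc (hb i)
  have h1 : P.real (Set.univ.pi J) ≤ (∫ x, F x ∂P).re := by
    rw [← integral_indicator_one hmeas]
    have h2 : ∫ x, (F x).re ∂P = (∫ x, F x ∂P).re := integral_re hFint
    rw [← h2]
    exact integral_mono ((integrable_const 1).indicator hmeas) hFint.re hge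
  have h2 : ∫ x, F x ∂P = ∑ h ∈ frequencies d N, (∏ i, c i (h i)) * ∫ x, torusChar h x ∂P := by
    rw [integral_finsetSum _ fun h _ => (integrable_torusChar P h).const_mul _]
    simp_rw [integral_const_mul]
  have hzero : (0 : Fin d → ℤ) ∈ frequencies d N := by
    simp [frequencies, hN]
  rw [h2, ← Finset.add_sum_erase _ _ hzero] at h1
  have h3 : ∫ x, torusChar (0 : Fin d → ℤ) x ∂P = 1 := by simp [torusChar]
  have h4 : ∏ i, c i ((0 : Fin d → ℤ) i) = ((∏ i, (b i - a i + 1 / N) : ℝ) : ℂ) := by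
    rw [Complex.ofReal_prod]
    exact Finset.prod_congr rfl fun i _ => hc0 i
  rw [h3, h4, mul_one, Complex.add_re, Complex.ofReal_re] at h1
  have h5 : (∑ h ∈ (frequencies d N).erase 0, (∏ i, c i (h i)) * ∫ x, torusChar h x ∂P).re ≤
      (1 + 1 / N : ℝ) ^ (d - 1) * (4 / 3) * fourierError P N := by
    refine (Complex.re_le_norm _).trans ((norm_sum_le _ _).trans ?_)
    rw [fourierError, Finset.mul_sum]
    refine Finset.sum_le_sum fun h hh => ?_
    rw [norm_mul]
    have := norm_prod_coeff_le (L := 1 + 1 / N)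
      (fun i h hh => (hcL i h hh).trans (by linarith [hb i])) hc' hh
    refine (mul_le_mul_of_nonneg_right this (norm_nonneg _)).trans (le_of_eq ?_)
    ring
  have h6 : (volume : Measure (Torus d)).real (Set.univ.pi J) = ∏ i, (b i - a i) := by
    rw [volume_real_pi]
    refine Finset.prod_congr rfl fun i _ => ?_
    rw [hJab i, volume_real_arc (hab i) (hb i)]
  have h7 := prod_add_sub_prod_le Finset.univ (fun i => b i - a i) (1 / N) hN1
    (fun i => sub_nonneg.2 (hab i)) (fun i => by linarith [hb i])
  rw [Finset.card_univ, Fintype.card_fin] at h7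
  rw [h6]
  linarith

theorem measureReal_pi_update {d : ℕ} (P : Measure (Torus d)) [IsFiniteMeasure P]
    (K : Fin d → Set UnitAddCircle) (i : Fin d) (hK : K i = Set.univ) {A : Set UnitAddCircle}
    (hA : MeasurableSet A) :
    P.real (Set.univ.pi (Function.update K i A)) + P.real (Set.univ.pi (Function.update K i Aᶜ)) =
      P.real (Set.univ.pi K) := by
  have key : ∀ B : Set UnitAddCircle, Set.univ.pi (Function.update K i B) =
      Set.univ.pi K ∩ (fun x : Torus d => x i) ⁻¹' B := by
    intro B
    ext x
    simp only [Set.mem_pi, Set.mem_univ, true_implies, Set.mem_inter_iff, Set.mem_preimage]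
    constructor
    · intro h
      refine ⟨fun j => ?_, by simpa using h i⟩
      rcases eq_or_ne j i with rfl | hj
      · rw [hK]; trivial
      · simpa [Function.update_of_ne hj] using h j
    · rintro ⟨h1, h2⟩ j
      rcases eq_or_ne j i with rfl | hj
      · simpa using h2
      · simpa [Function.update_of_ne hj] using h1 j
  rw [key, key, Set.preimage_compl, ← Set.sdiff_eq]
  exact measureReal_inter_add_sdiff (measurable_pi_apply i hA)

/-- If arcs bound the `P`-measure of products from above up to `E`, they do so from below up to
`d * E`. -/
theorem volume_pi_sub_le {d : ℕ} (P : Measure (Torus d)) [IsProbabilityMeasure P] {E : ℝ}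
    (hE : ∀ J : Fin d → Set UnitAddCircle, (∀ i, IsArc (J i)) →
      P.real (Set.univ.pi J) ≤ (volume : Measure (Torus d)).real (Set.univ.pi J) + E)
    {J : Fin d → Set UnitAddCircle} (hJ : ∀ i, IsArc (J i)) (s : Finset (Fin d)) :
    (volume : Measure (Torus d)).real (Set.univ.pi (s.piecewise J fun _ => Set.univ)) -
      P.real (Set.univ.pi (s.piecewise J fun _ => Set.univ)) ≤ s.card * E := by
  induction s using Finset.induction_on with
  | empty => simp [volume_real_univ]
  | insert i s hi ih =>
    rw [Finset.piecewise_insert, Finset.card_insert_of_notMem hi]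
    set K := s.piecewise J fun _ => Set.univ with hK
    have hKi : K i = Set.univ := by simp [hK, hi]
    -- Constraining coordinate `i` to `J i` removes the box with side `(J i)ᶜ`, again a product of
    -- arcs. The upper bound for that box costs one further `E`.
    have h1 := measureReal_pi_update P K i hKi (hJ i).measurableSet
    have h2 := measureReal_pi_update (volume : Measure (Torus d)) K i hKi (hJ i).measurableSet
    have h3 := hE (Function.update K i (J i)ᶜ) fun j => by
      rcases eq_or_ne j i with rfl | hj
      · simpa using (hJ j).compl
      · rw [Function.update_of_ne hj, hK]
        by_cases hjs : j ∈ s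
        · simpa [hjs] using hJ j
        · simpa [hjs] using isArc_univ
    push_cast
    linarith

/-- A form of the Erdős–Turán–Koksma inequality. -/
theorem discrepancy_le_fourierError {d N : ℕ} (hd : 1 ≤ d) (hN : 0 < N) (P : Measure (Torus d))
    [IsProbabilityMeasure P] :
    discrepancy P ≤
      d * ((1 + 1 / N) ^ d - 1 + (1 + 1 / N : ℝ) ^ (d - 1) * (4 / 3) * fourierError P N) := by
  set E := (1 + 1 / N : ℝ) ^ d - 1 + (1 + 1 / N : ℝ) ^ (d - 1) * (4 / 3) * fourierError P N with hEdef
  have hN1 : (0 : ℝ) ≤ 1 / N := by positivity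
  have hF : 0 ≤ fourierError P N := Finset.sum_nonneg fun h _ => by positivity
  have hE0 : 0 ≤ E := by
    have : (1 : ℝ) ≤ (1 + 1 / N) ^ d := one_le_pow₀ (by linarith)
    have : 0 ≤ (1 + 1 / N : ℝ) ^ (d - 1) * (4 / 3) * fourierError P N := by positivity
    linarith
  have hd1 : (1 : ℝ) ≤ d := by exact_mod_cast hd
  refine Real.sSup_le ?_ (by positivity)
  rintro r ⟨a, b, hab, rfl⟩
  rw [box_eq_pi]
  have hJ : ∀ i, IsArc (arc (a i) (b i)) := fun i => ⟨a i, b i, (hab i).1, (hab i).2, rfl⟩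
  have h1 := measureReal_pi_le hN P hJ
  have h2 := volume_pi_sub_le P (fun J hJ => measureReal_pi_le hN P hJ) hJ Finset.univ
  rw [Finset.piecewise_univ, Finset.card_univ, Fintype.card_fin] at h2
  rw [← hEdef] at h1 h2
  rw [abs_le]
  constructor
  · linarith
  · nlinarith

/-! ### Fourier coefficients of the walk -/

/-- For `v` the distance from `u` to the nearest integer, `cos (πv) = 1 - 2 sin² (πv/2)`, and the
chord of the concave sine on `[0, π/4]` gives `sin (πv/2) ≥ √2 v`. -/
theorem abs_cos_pi_mul_le (u : ℝ) : |Real.cos (Real.pi * u)| ≤ 1 - 4 * (u - round u) ^ 2 := by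
  have hw : |u - round u| ≤ 1 / 2 := abs_sub_round u
  have e : Real.pi * u = Real.pi * (u - round u) + (round u : ℤ) * Real.pi := by ring
  have hpi := Real.pi_pos
  rw [e, Real.cos_add_int_mul_pi, abs_mul, abs_zpow, abs_neg, abs_one, one_zpow, one_mul]
  generalize u - round u = w at hw
  rw [← Real.cos_abs (Real.pi * w), abs_mul, abs_of_pos hpi, ← sq_abs w]
  have hw0 := abs_nonneg w
  generalize |w| = v at hw hw0
  rw [abs_of_nonneg (Real.cos_nonneg_of_mem_Icc ⟨by nlinarith, by nlinarith⟩)]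
  have h2 : Real.pi * v = 2 * (Real.pi * v / 2) := by ring
  rw [h2, Real.cos_two_mul, Real.cos_sq']
  have h0mem : (0 : ℝ) ∈ Set.Icc 0 Real.pi := ⟨le_rfl, hpi.le⟩
  have hmem : Real.pi / 4 ∈ Set.Icc 0 Real.pi := ⟨by positivity, by linarith⟩
  have hc := strictConcaveOn_sin_Icc.concaveOn.2 h0mem hmem
    (show 0 ≤ 1 - 2 * v by linarith) (show 0 ≤ 2 * v by linarith) (by ring)
  simp only [smul_eq_mul, mul_zero, Real.sin_zero, zero_add, Real.sin_pi_div_four] at hc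
  rw [show 2 * v * (Real.pi / 4) = Real.pi * v / 2 by ring] at hc
  have h3 := pow_le_pow_left₀ (by positivity) hc 2
  have h4 : (2 * v * (√2 / 2)) ^ 2 = 2 * v ^ 2 := by
    have := Real.sq_sqrt (show (0 : ℝ) ≤ 2 by norm_num)
    linear_combination v ^ 2 * this
  linarith

theorem torusChar_add {d : ℕ} (h : Fin d → ℤ) (x y : Torus d) :
    torusChar h (x + y) = torusChar h x * torusChar h y := by
  unfold torusChar
  rw [← Finset.prod_mul_distrib]
  refine Finset.prod_congr rfl fun i _ => ?_
  simp only [fourier_apply, Pi.add_apply, smul_add, AddCircle.toCircle_add, Circle.coe_mul]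

theorem toTorus_neg {d : ℕ} (x : Fin d → ℝ) : toTorus (-x) = -toTorus x := by
  ext i
  simp [toTorus]

theorem torusChar_toTorus {d : ℕ} (h : Fin d → ℤ) (x : Fin d → ℝ) :
    torusChar h (toTorus x) = expChar 1 (∑ j, x j * h j) := by
  have : ∀ j, (fourier (h j) (toTorus x j) : ℂ) = expChar (h j) (x j) :=
    fun j => fourier_coe_eq_expChar (h j) (x j)
  unfold torusChar
  simp_rw [this]
  unfold expChar
  rw [← Complex.exp_sum]
  congr 1
  push_cast
  rw [Finset.mul_sum]
  exact Finset.sum_congr rfl fun j _ => by ring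

theorem integral_torusChar_conv {d : ℕ} (P Q : Measure (Torus d)) [IsFiniteMeasure P]
    [IsFiniteMeasure Q] (h : Fin d → ℤ) :
    ∫ x, torusChar h x ∂(Measure.conv P Q) =
      (∫ x, torusChar h x ∂P) * ∫ x, torusChar h x ∂Q := by
  unfold Measure.conv
  rw [integral_map (by fun_prop) (continuous_torusChar h).aestronglyMeasurable]
  simp_rw [torusChar_add]
  rw [integral_prod_mul]

theorem isProbabilityMeasure_generatingMeasure {n d : ℕ} (hn : 1 ≤ n)
    (A : Matrix (Fin n) (Fin d) ℝ) : IsProbabilityMeasure (generatingMeasure A) := by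
  constructor
  unfold generatingMeasure
  have hn0 : (n : ENNReal) ≠ 0 := by exact_mod_cast (by omega : n ≠ 0)
  simp only [Measure.smul_apply, Measure.coe_finsetSum, Finset.sum_apply, Measure.add_apply,
    measure_univ, Finset.sum_const, Finset.card_univ, Fintype.card_fin, smul_eq_mul, nsmul_eq_mul]
  rw [one_add_one_eq_two, mul_comm (n : ENNReal)]
  exact ENNReal.inv_mul_cancel (mul_ne_zero two_ne_zero hn0)
    (ENNReal.mul_ne_top (by simp) (ENNReal.natCast_ne_top n))

theorem isProbabilityMeasure_convPower {d : ℕ} (Q : Measure (Torus d)) [IsProbabilityMeasure Q]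
    (k : ℕ) : IsProbabilityMeasure (convPower Q k) := by
  induction k with
  | zero => unfold convPower; infer_instance
  | succ k ih => unfold convPower; infer_instance

theorem integral_torusChar_convPower {d : ℕ} (Q : Measure (Torus d)) [IsProbabilityMeasure Q]
    (k : ℕ) (h : Fin d → ℤ) :
    ∫ x, torusChar h x ∂(convPower Q k) = (∫ x, torusChar h x ∂Q) ^ k := by
  induction k with
  | zero => simp [convPower, torusChar]
  | succ k ih =>
    have := isProbabilityMeasure_convPower Q k
    rw [convPower, integral_torusChar_conv, ih, pow_succ]

theorem integral_torusChar_generatingMeasure {n d : ℕ} (A : Matrix (Fin n) (Fin d) ℝ)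
    (h : Fin d → ℤ) :
    ∫ x, torusChar h x ∂(generatingMeasure A) =
      ((∑ i, Real.cos (2 * Real.pi * A.mulVec (fun j => (h j : ℝ)) i)) / n : ℝ) := by
  have hi : ∀ x : Torus d, Integrable (torusChar h) (Measure.dirac x) :=
    fun x => integrable_torusChar _ h
  unfold generatingMeasure
  rw [integral_smul_measure, integral_finsetSum_measure fun i _ => (hi _).add_measure (hi _)]
  simp_rw [integral_add_measure (hi _) (hi _), integral_dirac, ← toTorus_neg, torusChar_toTorus]
  have h1 : ∀ i, expChar 1 (∑ j, A i j * h j) + expChar 1 (∑ j, (-A i) j * h j) =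
      ((2 * Real.cos (2 * Real.pi * A.mulVec (fun j => (h j : ℝ)) i) : ℝ) : ℂ) := by
    intro i
    have e1 : ∑ j, (-A i) j * (h j : ℝ) = -∑ j, A i j * h j := by
      rw [← Finset.sum_neg_distrib]
      exact Finset.sum_congr rfl fun j _ => by simp
    rw [e1, expChar_neg_right, expChar_eq, expChar_eq]
    simp only [Matrix.mulVec, dotProduct]
    push_cast
    simp only [mul_neg, neg_mul, mul_one, Complex.cos_neg, Complex.sin_neg]
    ring
  simp_rw [h1]
  rw [← Complex.ofReal_sum, ← Finset.mul_sum, ENNReal.toReal_inv, ENNReal.toReal_mul,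
    ENNReal.toReal_ofNat, ENNReal.toReal_natCast, Complex.real_smul, ← Complex.ofReal_mul]
  congr 1
  rw [mul_inv]
  ring

/-- The signed distance of `2 A h` from its nearest integral point. -/
noncomputable def doubledResidue {n d : ℕ} (A : Matrix (Fin n) (Fin d) ℝ) (h : Fin d → ℤ) (i : Fin n) : ℝ :=
  2 * A.mulVec (fun j => (h j : ℝ)) i - round (2 * A.mulVec (fun j => (h j : ℝ)) i)

/-- `|cos (2πt)|` is `1` at half-integers too, so the relevant distance is that of `2t`, not `t`,
from the integers. The mean of the cosine bounds is turned into an exponential by `1 - t ≤ exp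
(-t)`. -/
theorem norm_integral_torusChar_walk_le {n d : ℕ} (hn : 1 ≤ n) (k : ℕ)
    (A : Matrix (Fin n) (Fin d) ℝ) (h : Fin d → ℤ) :
    ‖∫ x, torusChar h x ∂(convPower (generatingMeasure A) k)‖ ≤
      Real.exp (-(4 * k / n * ∑ i, doubledResidue A h i ^ 2)) := by
  have := isProbabilityMeasure_generatingMeasure hn A
  have hn0 : (0 : ℝ) < n := by exact_mod_cast hn
  rw [integral_torusChar_convPower, norm_pow, integral_torusChar_generatingMeasure,
    Complex.norm_real, Real.norm_eq_abs]
  have h1 : |(∑ i, Real.cos (2 * Real.pi * A.mulVec (fun j => (h j : ℝ)) i)) / (n : ℝ)| ≤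
      Real.exp (-(4 / n * ∑ i, doubledResidue A h i ^ 2)) := by
    rw [abs_div, Nat.abs_cast]
    have h2 : |∑ i, Real.cos (2 * Real.pi * A.mulVec (fun j => (h j : ℝ)) i)| ≤
        ∑ i, (1 - 4 * doubledResidue A h i ^ 2) := by
      refine (Finset.abs_sum_le_sum_abs _ _).trans (Finset.sum_le_sum fun i _ => ?_)
      rw [show 2 * Real.pi * A.mulVec (fun j => (h j : ℝ)) i =
        Real.pi * (2 * A.mulVec (fun j => (h j : ℝ)) i) by ring]
      exact abs_cos_pi_mul_le _
    have h3 := Real.add_one_le_exp (-(4 / n * ∑ i, doubledResidue A h i ^ 2))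
    refine le_trans ?_ h3
    rw [div_le_iff₀ hn0]
    refine h2.trans (le_of_eq ?_)
    rw [Finset.sum_sub_distrib, ← Finset.mul_sum]
    simp
    field_simp
    ring
  refine (pow_le_pow_left₀ (abs_nonneg _) h1 k).trans (le_of_eq ?_)
  rw [← Real.exp_nat_mul]
  congr 1
  ring

/-! ### Gaussian sums over separated points -/

/-- The distance (in cells) of the cell `[z, z + 1)` from the origin. -/
def cellDist (z : ℤ) : ℕ := (max z (-z - 1)).toNat

theorem cellDist_cast (z : ℤ) : (cellDist z : ℤ) = max z (-z - 1) := by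
  unfold cellDist
  omega

theorem sum_pow_cellDist (q : ℝ) (K : ℕ) :
    ∑ z ∈ Finset.Ico (-(K : ℤ)) K, q ^ cellDist z = 2 * ∑ j ∈ Finset.range K, q ^ j := by
  induction K with
  | zero => simp
  | succ K ih =>
    have : Finset.Ico (-((K + 1 : ℕ) : ℤ)) ((K + 1 : ℕ) : ℤ) =
        insert (K : ℤ) (insert (-(K : ℤ) - 1) (Finset.Ico (-(K : ℤ)) K)) := by
      ext z
      simp only [Finset.mem_insert, Finset.mem_Ico]
      push_cast
      omega
    have e1 : cellDist (K : ℤ) = K := by unfold cellDist; omega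
    have e2 : cellDist (-(K : ℤ) - 1) = K := by unfold cellDist; omega
    rw [this, Finset.sum_insert (by simp; omega), Finset.sum_insert (by simp), ih,
      Finset.sum_range_succ, e1, e2]
    ring

theorem cellDist_floor_le {w δ : ℝ} (hδ : 0 < δ) : δ * cellDist ⌊w / δ⌋ ≤ |w| := by
  have h1 := Int.floor_le (w / δ)
  have h2 := Int.lt_floor_add_one (w / δ)
  have hc : (cellDist ⌊w / δ⌋ : ℝ) = max (⌊w / δ⌋ : ℝ) (-⌊w / δ⌋ - 1) := by
    exact_mod_cast cellDist_cast ⌊w / δ⌋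
  have h3 : (cellDist ⌊w / δ⌋ : ℝ) ≤ |w / δ| := by
    rw [hc]
    refine max_le (h1.trans (le_abs_self _)) (le_trans ?_ (neg_le_abs _))
    linarith
  rw [abs_div, abs_of_pos hδ, le_div_iff₀ hδ] at h3
  linarith

/-- A Gaussian sum over points which are separated, and bounded away from the origin, in the sup
norm. -/
theorem sum_exp_neg_le {ι : Type*} {n : ℕ} (s : Finset ι) (w : ι → Fin n → ℝ) {δ β : ℝ}
    (hδ : 0 < δ) (hβ : 0 < β)
    (hsep : ∀ x ∈ s, ∀ y ∈ s, x ≠ y → ∃ i, δ ≤ |w x i - w y i|)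
    (haway : ∀ x ∈ s, ∃ i, δ < |w x i|) :
    ∑ x ∈ s, Real.exp (-(β * ∑ i, w x i ^ 2)) ≤
      (2 / (1 - Real.exp (-(β * δ ^ 2)))) ^ n - 2 ^ n := by
  classical
  set q := Real.exp (-(β * δ ^ 2)) with hq
  have hq0 : 0 < q := Real.exp_pos _
  have hq1 : q < 1 := Real.exp_lt_one_iff.2 (by have := mul_pos hβ (pow_pos hδ 2); linarith)
  let c : ι → Fin n → ℤ := fun x i => ⌊w x i / δ⌋
  let g : (Fin n → ℤ) → ℝ := fun z => ∏ i, q ^ cellDist (z i)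
  have hg : ∀ z, 0 ≤ g z := fun z => Finset.prod_nonneg fun i _ => by positivity
  -- A coordinate in a cell at distance `m` has square at least `δ² m² ≥ δ² m`, which replaces the
  -- Gaussian by a geometric term.
  have hterm : ∀ x ∈ s, Real.exp (-(β * ∑ i, w x i ^ 2)) ≤ g (c x) := by
    intro x _
    simp only [g]
    rw [Finset.mul_sum, ← Finset.sum_neg_distrib, Real.exp_sum]
    refine Finset.prod_le_prod (fun i _ => (Real.exp_pos _).le) fun i _ => ?_
    rw [hq, ← Real.exp_nat_mul]
    refine Real.exp_le_exp.2 ?_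
    have h1 := pow_le_pow_left₀ (by positivity) (cellDist_floor_le (w := w x i) hδ) 2
    rw [sq_abs, mul_pow] at h1
    have h2 : (cellDist (c x i) : ℝ) ≤ (cellDist (c x i) : ℝ) ^ 2 := by
      exact_mod_cast Nat.le_self_pow two_ne_zero _
    have h3 : δ ^ 2 * (cellDist (c x i) : ℝ) ≤ w x i ^ 2 :=
      (mul_le_mul_of_nonneg_left h2 (sq_nonneg δ)).trans h1
    have := mul_le_mul_of_nonneg_left h3 hβ.le
    linarith
  have hinj : Set.InjOn c s := by
    intro x hx y hy hxy
    by_contra hne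
    obtain ⟨i, hi⟩ := hsep x hx y hy hne
    have h1 := Int.abs_sub_lt_one_of_floor_eq_floor (congrFun hxy i)
    rw [← sub_div, abs_div, abs_of_pos hδ, div_lt_one hδ] at h1
    linarith
  let K : ℕ := 1 + s.sup fun x => Finset.univ.sup fun i => (c x i).natAbs + 1
  have hK : 1 ≤ K := Nat.le_add_right _ _
  let big : Finset (Fin n → ℤ) := Fintype.piFinset fun _ => Finset.Ico (-(K : ℤ)) K
  -- The `2 ^ n` cells touching the origin, with all indices in `{-1, 0}`. By `haway` they contain
  -- no point, which yields the subtracted `2 ^ n`.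
  let small : Finset (Fin n → ℤ) := Fintype.piFinset fun _ => Finset.Ico (-((1 : ℕ) : ℤ)) (1 : ℕ)
  have hsub : small ⊆ big := by
    refine Fintype.piFinset_subset _ _ fun _ => Finset.Ico_subset_Ico ?_ ?_
    · omega
    · omega
  have himg : s.image c ⊆ big \ small := by
    intro z hz
    obtain ⟨x, hx, rfl⟩ := Finset.mem_image.1 hz
    rw [Finset.mem_sdiff]
    constructor
    · rw [Fintype.mem_piFinset]
      intro i
      have h1 : (c x i).natAbs + 1 ≤ Finset.univ.sup fun i => (c x i).natAbs + 1 :=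
        Finset.le_sup (f := fun i => (c x i).natAbs + 1) (Finset.mem_univ i)
      have h2 := Finset.le_sup (f := fun x => Finset.univ.sup fun i => (c x i).natAbs + 1) hx
      rw [Finset.mem_Ico]
      simp only [K]
      omega
    · intro hsm
      rw [Fintype.mem_piFinset] at hsm
      obtain ⟨i, hi⟩ := haway x hx
      have h1 := Finset.mem_Ico.1 (hsm i)
      have h2 := Int.floor_le (w x i / δ)
      have h3 := Int.lt_floor_add_one (w x i / δ)
      have h4 : (-1 : ℝ) ≤ ⌊w x i / δ⌋ := by exact_mod_cast h1.1
      have h5 : (⌊w x i / δ⌋ : ℝ) ≤ 0 := by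
        have : ⌊w x i / δ⌋ ≤ 0 := by have := h1.2; simp only [c] at this; omega
        exact_mod_cast this
      have h6 : |w x i / δ| ≤ 1 := abs_le.2 ⟨by linarith, by linarith⟩
      rw [abs_div, abs_of_pos hδ, div_le_one hδ] at h6
      linarith
  have hpow : ∀ M : ℕ, ∑ z ∈ Fintype.piFinset (fun _ : Fin n => Finset.Ico (-(M : ℤ)) M), g z =
      (2 * ∑ j ∈ Finset.range M, q ^ j) ^ n := by
    intro M
    have := Finset.sum_prod_piFinset (ι := Fin n) (Finset.Ico (-(M : ℤ)) M)
      (fun _ z => q ^ cellDist z)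
    simp only [g]
    rw [this, sum_pow_cellDist]
    simp
  calc ∑ x ∈ s, Real.exp (-(β * ∑ i, w x i ^ 2)) ≤ ∑ x ∈ s, g (c x) := Finset.sum_le_sum hterm
    _ = ∑ z ∈ s.image c, g z := (Finset.sum_image hinj).symm
    _ ≤ ∑ z ∈ big \ small, g z := Finset.sum_le_sum_of_subset_of_nonneg himg fun z _ _ => hg z
    _ = ∑ z ∈ big, g z - ∑ z ∈ small, g z := by
      rw [← Finset.sum_sdiff hsub, add_sub_cancel_right]
    _ ≤ (2 / (1 - q)) ^ n - 2 ^ n := by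
      simp only [big, small]
      rw [hpow, hpow]
      have h1 : ∑ j ∈ Finset.range K, q ^ j ≤ 1 / (1 - q) := by
        rw [le_div_iff₀ (by linarith)]
        have := geom_sum_mul q K
        have : 0 < q ^ K := by positivity
        nlinarith
      have h2 : 2 * ∑ j ∈ Finset.range K, q ^ j ≤ 2 / (1 - q) := by
        rw [show 2 / (1 - q) = 2 * (1 / (1 - q)) by ring]
        linarith
      have h3 := pow_le_pow_left₀ (by positivity) h2 n
      have h4 : 2 * ∑ j ∈ Finset.range 1, q ^ j = 2 := by simp
      rw [h4]
      linarith

/-! ### Bad approximability and the Fourier sum -/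

theorem exists_lt_abs_sub_of_lt_distInt {n : ℕ} {v : Fin n → ℝ} {ε : ℝ} (hε : 0 ≤ ε)
    (h : ε < distInt v) (z : Fin n → ℤ) : ∃ i, ε < |v i - z i| := by
  by_contra! hcon
  have h1 : dist v (fun i => (z i : ℝ)) ≤ ε :=
    (dist_pi_le_iff hε).2 fun i => by rw [Real.dist_eq]; exact hcon i
  have h2 := Metric.infDist_le_dist_of_mem (x := v)
    (Set.mem_range_self (f := fun (z : Fin n → ℤ) (i : Fin n) => (z i : ℝ)) z)
  unfold distInt at h
  linarith

theorem norm_le_of_mem_frequencies {d N : ℕ} {h : Fin d → ℤ} (hh : h ∈ frequencies d (N + 1)) :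
    ‖h‖ ≤ N := by
  rw [frequencies, Fintype.mem_piFinset] at hh
  refine (pi_norm_le_iff_of_nonneg (Nat.cast_nonneg N)).2 fun i => ?_
  have := Finset.mem_Ioo.1 (hh i)
  rw [Int.norm_eq_abs]
  have h1 : |h i| ≤ (N : ℤ) := by rw [abs_le]; omega
  exact_mod_cast h1

/-- Bad approximability is applied to the integral vector `2h`. Because `z` is arbitrary, this
serves both for residues and for differences of residues. -/
theorem IsApproximationConstant.exists_lt_abs_sub {n d : ℕ} {A : Matrix (Fin n) (Fin d) ℝ} {C : ℝ}
    (hA : IsApproximationConstant A C) {h : Fin d → ℤ} (h0 : h ≠ 0) {L : ℝ} (hL : ‖h‖ ≤ L)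
    (z : Fin n → ℤ) :
    ∃ i, C / (2 * L) ^ ((d : ℝ) / n) < |2 * A.mulVec (fun j => (h j : ℝ)) i - z i| := by
  have hC := hA.1
  have hpos : 0 < ‖h‖ := norm_pos_iff.2 h0
  have h20 : h + h ≠ 0 := by
    intro h2
    apply h0
    ext j
    have := congrFun h2 j
    simp only [Pi.add_apply, Pi.zero_apply] at this ⊢
    omega
  have h1 := hA.2 (h + h) h20
  have h2 : ‖h + h‖ ≤ 2 * L := (norm_add_le _ _).trans (by linarith)
  have h3 : C / (2 * L) ^ ((d : ℝ) / n) ≤ C / ‖h + h‖ ^ ((d : ℝ) / n) :=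
    div_le_div_of_nonneg_left hC.le (Real.rpow_pos_of_pos (norm_pos_iff.2 h20) _)
      (Real.rpow_le_rpow (norm_nonneg _) h2 (by positivity))
  have hnn : 0 ≤ C / (2 * L) ^ ((d : ℝ) / n) :=
    div_nonneg hC.le (Real.rpow_nonneg (by linarith) _)
  obtain ⟨i, hi⟩ := exists_lt_abs_sub_of_lt_distInt hnn (h3.trans_lt h1) z
  refine ⟨i, ?_⟩
  have : A.mulVec (fun j => ((h + h) j : ℝ)) i = 2 * A.mulVec (fun j => (h j : ℝ)) i := by
    simp only [Matrix.mulVec, dotProduct, Pi.add_apply]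
    rw [Finset.mul_sum]
    exact Finset.sum_congr rfl fun j _ => by push_cast; ring
  rwa [this] at hi

/-- With `q = exp (-n)` one has `nq ≤ 1/2`, so Bernoulli gives `(1 - q)⁻ⁿ ≤ 1 + 2nq ≤ 2`. The
bracket is then at most `2 ^ n ≤ exp n`. -/
theorem exp_neg_mul_pow_sub_le_one {n : ℕ} (hn : 1 ≤ n) :
    Real.exp (-n) * ((2 / (1 - Real.exp (-n))) ^ n - 2 ^ n) ≤ 1 := by
  have he := Real.exp_pos (-(n : ℝ))
  have h2n : (2 : ℝ) ^ n * Real.exp (-n) ≤ 1 := by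
    have h1 : (2 : ℝ) ^ n ≤ Real.exp n := by
      rw [← Real.exp_one_pow]
      refine pow_le_pow_left₀ zero_le_two ?_ n
      have := Real.exp_one_gt_d9
      linarith
    rw [Real.exp_neg]
    exact (div_le_one (Real.exp_pos _)).2 h1
  have hnq : (n : ℝ) * Real.exp (-n) ≤ 1 / 2 := by
    have h1 : 2 * n ≤ 2 ^ n := by
      obtain ⟨m, rfl⟩ : ∃ m, n = m + 1 := ⟨n - 1, by omega⟩
      have := m.lt_two_pow_self
      rw [pow_succ]
      omega
    have h2 : (2 : ℝ) * n ≤ 2 ^ n := by exact_mod_cast h1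
    nlinarith
  generalize Real.exp (-(n : ℝ)) = q at *
  have hn1 : (1 : ℝ) ≤ n := by exact_mod_cast hn
  have hq : q ≤ 1 / 2 := by nlinarith
  have hb := one_add_mul_le_pow (a := -q) (by linarith) n
  have hb' : 1 - n * q ≤ (1 - q) ^ n := by
    rw [← sub_eq_add_neg] at hb; linarith
  have h3 : (2 / (1 - q)) ^ n ≤ 2 ^ n * (1 + 2 * (n * q)) := by
    rw [div_pow, div_le_iff₀ (pow_pos (by linarith) n), mul_assoc]
    refine le_mul_of_one_le_right (by positivity) ?_
    have h4 : 0 ≤ n * q := by positivity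
    have := mul_le_mul_of_nonneg_left hb' (show 0 ≤ 1 + 2 * (n * q) by linarith)
    nlinarith
  have h5 : (2 : ℝ) ^ n * (1 + 2 * (n * q)) - 2 ^ n ≤ 2 ^ n := by
    have : (0 : ℝ) < 2 ^ n := by positivity
    nlinarith
  calc q * ((2 / (1 - q)) ^ n - 2 ^ n) ≤ q * 2 ^ n :=
        mul_le_mul_of_nonneg_left (by linarith) he.le
    _ ≤ 1 := by linarith

/-- The exponent `4k/n` is split as `2β`. One factor `exp (-β ∑ r²)` is bounded pointwise by `exp
(-n) ‖h‖ / (4R)`, cancelling the weight `1/‖h‖`; the other is summed over the separated residues.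
The relation `hRC` says exactly that `β δ² = n`. -/
theorem fourierError_walk_le {n d k : ℕ} (hn : 1 ≤ n) (hd : 1 ≤ d) (hk : 1 ≤ k)
    {A : Matrix (Fin n) (Fin d) ℝ} {C : ℝ} (hA : IsApproximationConstant A C) {R : ℝ} (hR : 0 < R)
    (hRC : 2 * k * C ^ 2 = n ^ 2 * ((4 * R) ^ ((d : ℝ) / n)) ^ 2) :
    fourierError (convPower (generatingMeasure A) k) (⌊R⌋₊ + 1) ≤ 1 / (4 * R) := by
  have hC := hA.1
  have hn0 : (0 : ℝ) < n := by exact_mod_cast hn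
  have hk0 : (0 : ℝ) < k := by exact_mod_cast hk
  have hd1 : (1 : ℝ) ≤ d := by exact_mod_cast hd
  have hfloor : (⌊R⌋₊ : ℝ) ≤ R := Nat.floor_le hR.le
  set p : ℝ := (d : ℝ) / n with hp
  have hpn : n * p = d := by rw [hp]; field_simp
  set s := (frequencies d (⌊R⌋₊ + 1)).erase 0 with hs
  -- Differences of frequencies have norm at most `2R`, and doubling them gives `4R`.
  set δ := C / (4 * R) ^ p with hδ
  set β : ℝ := 2 * k / n with hβ
  have hRp : 0 < (4 * R) ^ p := Real.rpow_pos_of_pos (by linarith) p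
  have hδ0 : 0 < δ := div_pos hC hRp
  have hβ0 : 0 < β := by positivity
  have hβδ : β * δ ^ 2 = n := by
    rw [hβ, hδ, div_pow]
    field_simp
    linarith
  have hsnorm : ∀ h ∈ s, h ≠ 0 ∧ ‖h‖ ≤ R := fun h hh => by
    rw [hs, Finset.mem_erase] at hh
    exact ⟨hh.1, (norm_le_of_mem_frequencies hh.2).trans hfloor⟩
  have hcount := sum_exp_neg_le s (doubledResidue A) hδ0 hβ0 (by
    intro x hx y hy hxy
    obtain ⟨i, hi⟩ := hA.exists_lt_abs_sub (h := x - y) (sub_ne_zero.2 hxy) (L := 2 * R)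
      ((norm_sub_le _ _).trans (by linarith [(hsnorm x hx).2, (hsnorm y hy).2]))
      (fun i => round (2 * A.mulVec (fun j => (x j : ℝ)) i) -
        round (2 * A.mulVec (fun j => (y j : ℝ)) i))
    refine ⟨i, ?_⟩
    rw [← hp, show 2 * (2 * R) = 4 * R by ring] at hi
    refine hi.le.trans (le_of_eq ?_)
    congr 1
    have : A.mulVec (fun j => ((x - y) j : ℝ)) i =
        A.mulVec (fun j => (x j : ℝ)) i - A.mulVec (fun j => (y j : ℝ)) i := by
      simp only [Matrix.mulVec, dotProduct, Pi.sub_apply]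
      rw [← Finset.sum_sub_distrib]
      exact Finset.sum_congr rfl fun j _ => by push_cast; ring
    rw [this]
    unfold doubledResidue
    push_cast
    ring) (by
    intro x hx
    obtain ⟨i, hi⟩ := hA.exists_lt_abs_sub (h := x) (hsnorm x hx).1 (L := 2 * R)
      (by linarith [(hsnorm x hx).2]) (fun i => round (2 * A.mulVec (fun j => (x j : ℝ)) i))
    refine ⟨i, ?_⟩
    rwa [← hp, show 2 * (2 * R) = 4 * R by ring] at hi)
  rw [hβδ] at hcount
  have hpt : ∀ h ∈ s, Real.exp (-(β * ∑ i, doubledResidue A h i ^ 2)) ≤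
      Real.exp (-n) * (‖h‖ / (4 * R)) := by
    intro h hh
    obtain ⟨h0, hhR⟩ := hsnorm h hh
    have hpos : 0 < ‖h‖ := norm_pos_iff.2 h0
    obtain ⟨i, hi⟩ := hA.exists_lt_abs_sub h0 le_rfl
      (fun i => round (2 * A.mulVec (fun j => (h j : ℝ)) i))
    rw [← hp] at hi
    have hhp : 0 < (2 * ‖h‖) ^ p := Real.rpow_pos_of_pos (by linarith) p
    have h1 : (C / (2 * ‖h‖) ^ p) ^ 2 ≤ ∑ i, doubledResidue A h i ^ 2 := by
      have h2 := pow_le_pow_left₀ (by positivity) hi.le 2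
      rw [sq_abs] at h2
      exact h2.trans (Finset.single_le_sum (f := fun i => doubledResidue A h i ^ 2)
        (fun i _ => sq_nonneg _) (Finset.mem_univ i))
    set y := 2 * R / ‖h‖ with hy
    have hy0 : 0 < y := by positivity
    have hy2 : 2 ≤ y := by rw [hy, le_div_iff₀ hpos]; linarith
    have h2 : β * (C / (2 * ‖h‖) ^ p) ^ 2 = n * (y ^ p) ^ 2 := by
      have e : (4 * R) ^ p = y ^ p * (2 * ‖h‖) ^ p := by
        rw [← Real.mul_rpow hy0.le (by linarith), hy]
        congr 1
        field_simp
        ring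
      rw [e] at hRC
      rw [hβ, div_pow]
      field_simp
      linarith
    -- From `exp t ≥ 1 + t`, `y ^ (2p) ≥ 1 + 2p log y`, and `np = d ≥ 1`. The resulting `y⁻²` is at
    -- most `(2y)⁻¹ = ‖h‖ / (4R)` since `y ≥ 2`.
    have h3 : n + 2 * Real.log y ≤ n * (y ^ p) ^ 2 := by
      have h4 : 1 + 2 * p * Real.log y ≤ (y ^ p) ^ 2 := by
        rw [← Real.rpow_natCast, ← Real.rpow_mul hy0.le, Real.rpow_def_of_pos hy0]
        have := Real.add_one_le_exp (Real.log y * (p * (2 : ℕ)))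
        push_cast at this ⊢
        linarith
      have h5 : 0 ≤ Real.log y := Real.log_nonneg (by linarith)
      have h6 := mul_le_mul_of_nonneg_left h4 hn0.le
      have h7 : n * (1 + 2 * p * Real.log y) = n + 2 * d * Real.log y := by
        rw [← hpn]; ring
      rw [h7] at h6
      nlinarith
    have h4 : β * (C / (2 * ‖h‖) ^ p) ^ 2 ≤ β * ∑ i, doubledResidue A h i ^ 2 :=
      mul_le_mul_of_nonneg_left h1 hβ0.le
    calc Real.exp (-(β * ∑ i, doubledResidue A h i ^ 2)) ≤ Real.exp (-n + -(2 * Real.log y)) :=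
          Real.exp_le_exp.2 (by linarith)
      _ = Real.exp (-n) * (y ^ 2)⁻¹ := by
          rw [Real.exp_add, Real.exp_neg (2 * Real.log y), mul_comm 2 (Real.log y)]
          congr 2
          rw [← Nat.cast_ofNat (n := 2), mul_comm, Real.exp_nat_mul, Real.exp_log hy0]
      _ ≤ Real.exp (-n) * (‖h‖ / (4 * R)) := by
          refine mul_le_mul_of_nonneg_left ?_ (Real.exp_pos _).le
          have e : ‖h‖ / (4 * R) = (2 * y)⁻¹ := by rw [hy]; field_simp; ring
          rw [e]
          exact inv_anti₀ (by positivity) (by nlinarith)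
  unfold fourierError
  have hterm : ∀ h ∈ s, ‖∫ x, torusChar h x ∂(convPower (generatingMeasure A) k)‖ / ‖h‖ ≤
      Real.exp (-n) / (4 * R) * Real.exp (-(β * ∑ i, doubledResidue A h i ^ 2)) := by
    intro h hh
    have hpos : 0 < ‖h‖ := norm_pos_iff.2 (hsnorm h hh).1
    rw [div_le_iff₀ hpos]
    refine (norm_integral_torusChar_walk_le hn k A h).trans ?_
    have e : -(4 * k / n * ∑ i, doubledResidue A h i ^ 2) =
        -(β * ∑ i, doubledResidue A h i ^ 2) + -(β * ∑ i, doubledResidue A h i ^ 2) := by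
      rw [hβ]; ring
    rw [e, Real.exp_add]
    refine (mul_le_mul_of_nonneg_right (hpt h hh) (Real.exp_pos _).le).trans (le_of_eq ?_)
    ring
  refine (Finset.sum_le_sum hterm).trans ?_
  rw [← Finset.mul_sum]
  have h1 := mul_le_mul_of_nonneg_left hcount
    (show 0 ≤ Real.exp (-n) / (4 * R) by positivity)
  have h2 := exp_neg_mul_pow_sub_le_one hn
  refine h1.trans ?_
  rw [div_mul_eq_mul_div]
  exact div_le_div_of_nonneg_right h2 (by positivity)

/-! ### Numerical constants and the trivial bound -/

theorem dimension_bounds {d : ℕ} (hd : 1 ≤ d) :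
    (d : ℝ) ≤ 8 / 9 * (3 / 2) ^ d ∧ 45 / 37 * (d * (d + 1 / 3) : ℝ) ≤ 5 * (3 / 2) ^ d := by
  rcases le_or_gt d 6 with h | h
  · interval_cases d <;> norm_num
  · induction d, h using Nat.le_induction with
    | base => norm_num
    | succ m hm ih =>
      obtain ⟨h1, h2⟩ := ih (by omega)
      have hm' : (7 : ℝ) ≤ m := by exact_mod_cast hm
      push_cast
      rw [pow_succ]
      constructor
      · linarith
      · nlinarith

/-- Since `(1 + z)(1 - z) ≤ 1`, Bernoulli gives `(1 + z) ^ m ≤ 1 / (1 - mz)`; the slope `45/37` is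
`1 / (1 - 8/45)`. -/
theorem one_add_pow_le {z : ℝ} {m : ℕ} (hz : 0 ≤ z) (hmz : m * z ≤ 8 / 45) :
    (1 + z) ^ m ≤ 1 + 45 / 37 * (m * z) := by
  rcases Nat.eq_zero_or_pos m with rfl | hm
  · simp
  have hm1 : (1 : ℝ) ≤ m := by exact_mod_cast hm
  have hz1 : z ≤ 8 / 45 := by nlinarith
  have hb := one_add_mul_le_pow (a := -z) (by linarith) m
  have h1 : (1 + z) ^ m * (1 + -z) ^ m ≤ 1 := by
    rw [← mul_pow]
    exact pow_le_one₀ (by nlinarith) (by nlinarith)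
  have h2 : (1 + z) ^ m * (1 - m * z) ≤ 1 := by
    refine le_trans (mul_le_mul_of_nonneg_left ?_ (by positivity)) h1
    linarith
  have h3 : 0 ≤ m * z := by positivity
  have h4 : 1 ≤ (1 + 45 / 37 * (m * z)) * (1 - m * z) := by nlinarith
  have h5 : 0 < 1 - m * z := by linarith
  exact le_of_mul_le_mul_right (h2.trans h4) h5

/-- The size of `R` forces `d / R ≤ 8/45`, so powers of `1 + x` linearize. The bracket is at most
`(45/37)(d + 1/3) / R`, and its product with `d` is absorbed by `5 (3/2) ^ d / R`. -/
theorem etk_bound_le {d : ℕ} (hd : 1 ≤ d) {R x S : ℝ} (hR : 5 * (3 / 2) ^ d ≤ R) (hx0 : 0 ≤ x)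
    (hx : x ≤ 1 / R) (hS0 : 0 ≤ S) (hS : S ≤ 1 / (4 * R)) :
    d * ((1 + x) ^ d - 1 + (1 + x) ^ (d - 1) * (4 / 3) * S) ≤ 5 * (3 / 2) ^ d / R := by
  obtain ⟨h1, h2⟩ := dimension_bounds hd
  have hpos : (0 : ℝ) < (3 / 2) ^ d := by positivity
  have hR0 : 0 < R := by linarith
  have hd0 : (0 : ℝ) ≤ d := Nat.cast_nonneg d
  have hz0 : 0 ≤ 1 / R := by positivity
  have hdz : d * (1 / R) ≤ 8 / 45 := by
    rw [mul_one_div, div_le_iff₀ hR0]; linarith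
  have hdx : d * x ≤ d * (1 / R) := mul_le_mul_of_nonneg_left hx hd0
  have h3 := one_add_pow_le hx0 (hdx.trans hdz)
  have h4 : (1 + x) ^ (d - 1) ≤ 45 / 37 := by
    have : (1 + x) ^ (d - 1) ≤ (1 + x) ^ d := pow_le_pow_right₀ (by linarith) (by omega)
    linarith
  have h5 : (1 + x) ^ (d - 1) * (4 / 3) * S ≤ 45 / 37 * (4 / 3) * (1 / (4 * R)) :=
    mul_le_mul (by linarith) hS hS0 (by norm_num)
  have h6 : (1 + x) ^ d - 1 + (1 + x) ^ (d - 1) * (4 / 3) * S ≤ 45 / 37 * (d + 1 / 3) * (1 / R) := by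
    have e : 45 / 37 * (4 / 3) * (1 / (4 * R)) = 45 / 37 * (1 / 3) * (1 / R) := by
      field_simp
    rw [e] at h5
    linarith
  refine (mul_le_mul_of_nonneg_left h6 hd0).trans ?_
  have h7 := mul_le_mul_of_nonneg_right h2 hz0
  refine le_trans (le_of_eq ?_) (h7.trans (le_of_eq ?_))
  · ring
  · ring

theorem discrepancy_le_one {d : ℕ} (P : Measure (Torus d)) [IsProbabilityMeasure P] :
    discrepancy P ≤ 1 := by
  refine Real.sSup_le ?_ zero_le_one
  rintro r ⟨a, b, hab, rfl⟩
  have h1 : P.real (box a b) ≤ 1 := measureReal_le_one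
  have h2 : (volume : Measure (Torus d)).real (box a b) ≤ 1 :=
    (measureReal_mono (Set.subset_univ _)).trans (volume_real_univ d).le
  have h3 : 0 ≤ P.real (box a b) := measureReal_nonneg
  have h4 : 0 ≤ (volume : Measure (Torus d)).real (box a b) := measureReal_nonneg
  rw [abs_le]
  constructor <;> linarith

end TorusWalk

/-! ### Choice of the cutoff and conclusion -/

theorem theorem2 (n d k : ℕ) (hn : 1 ≤ n) (hd : 1 ≤ d) (hk : 1 ≤ k)
    (A : Matrix (Fin n) (Fin d) ℝ) (C : ℝ) (hA : TorusWalk.IsApproximationConstant A C) :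
    TorusWalk.discrepancy (TorusWalk.convPower (TorusWalk.generatingMeasure A) k) ≤
      (3 / 2 : ℝ) ^ d * 20 * ((n : ℝ) / (C * Real.sqrt 2)) ^ ((n : ℝ) / (d : ℝ)) *
        (k : ℝ) ^ (-((n : ℝ) / (2 * (d : ℝ)))) := by
  have := TorusWalk.isProbabilityMeasure_generatingMeasure hn A
  have := TorusWalk.isProbabilityMeasure_convPower (TorusWalk.generatingMeasure A) k
  have hC := hA.1
  have hn0 : (0 : ℝ) < n := by exact_mod_cast hn
  have hd0 : (0 : ℝ) < d := by exact_mod_cast hd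
  have hk0 : (0 : ℝ) < k := by exact_mod_cast hk
  have h2 : (0 : ℝ) < √2 := by positivity
  set B : ℝ := C * √2 * √k / n with hB
  have hB0 : 0 < B := by positivity
  -- `R` solves `(4R) ^ (d/n) = B`, the balance required by `fourierError_walk_le`. The `4` turns
  -- the constant `5` of `etk_bound_le` into `20`.
  set R : ℝ := B ^ ((n : ℝ) / d) / 4 with hR
  have hR0 : 0 < R := by positivity
  have hRp : (4 * R) ^ ((d : ℝ) / n) = B := by
    rw [hR, mul_div_cancel₀ _ four_ne_zero, ← Real.rpow_mul hB0.le, div_mul_div_cancel₀ hd0.ne',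
      div_self hn0.ne', Real.rpow_one]
  have hRC : 2 * k * C ^ 2 = n ^ 2 * ((4 * R) ^ ((d : ℝ) / n)) ^ 2 := by
    rw [hRp, hB, div_pow, mul_pow, mul_pow, Real.sq_sqrt zero_le_two, Real.sq_sqrt hk0.le]
    field_simp
  have hrhs : (3 / 2 : ℝ) ^ d * 20 * ((n : ℝ) / (C * √2)) ^ ((n : ℝ) / (d : ℝ)) *
      (k : ℝ) ^ (-((n : ℝ) / (2 * (d : ℝ)))) = 5 * (3 / 2) ^ d / R := by
    have e1 : (k : ℝ) ^ (-((n : ℝ) / (2 * (d : ℝ)))) = ((√k)⁻¹) ^ ((n : ℝ) / d) := by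
      rw [Real.sqrt_eq_rpow, ← Real.rpow_neg hk0.le, ← Real.rpow_mul hk0.le]
      congr 1
      field_simp
    rw [e1, mul_assoc, ← Real.mul_rpow (by positivity) (by positivity)]
    have e2 : (n : ℝ) / (C * √2) * (√k)⁻¹ = B⁻¹ := by
      rw [hB]; field_simp
    rw [e2, Real.inv_rpow hB0.le, hR]
    field_simp
    norm_num
  rw [hrhs]
  -- Taking `N = ⌊R⌋₊ + 1` keeps the frequencies within norm `R` and makes `1/N ≤ 1/R`. In the other
  -- case the right side exceeds `1`.
  rcases le_or_gt (5 * (3 / 2 : ℝ) ^ d) R with h | h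
  · refine (TorusWalk.discrepancy_le_fourierError hd (Nat.succ_pos ⌊R⌋₊) _).trans ?_
    refine TorusWalk.etk_bound_le hd h (by positivity) ?_
      (Finset.sum_nonneg fun h _ => by positivity)
      (TorusWalk.fourierError_walk_le hn hd hk hA hR0 hRC)
    refine one_div_le_one_div_of_le hR0 ?_
    push_cast
    exact (Nat.lt_floor_add_one R).le
  · refine (TorusWalk.discrepancy_le_one _).trans ?_
    rw [one_le_div hR0]
    exact h.le
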